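/- Conventions. Write $\mathbb{F}_m$ for the $m$-th Hirzebruch surface, the quotient of $(\mathbb{C}^2\setminus\{0\})^2$ by the relation $((x_0,x_1),(y_0,y_1))\sim((\mu x_0,\lambda^{-m}\mu x_1),(\lambda y_0,\lambda y_1))$ with $\lambda,\mu\in\mathbb{C}^*$, let $S_+\subset\mathbb{F}_m$ be the section $x_0=0$, and embed $\mathbb{A}^2$ in $\mathbb{F}_m$ by $\iota_m(x,y)=[x:1;y:1]$. A polynomial $F\in\mathbb{C}[x,y]$ has bidegree $(a,b)$ if its Newton polygon lies in the triangle spanned by $(a,0)$, $(0,0)$ and $(0,b)$. For a nonzero $F$ of bidegree $(a,am)$, an $(a,am)$-divisor of $F$ is an effective divisor $C$ on $\mathbb{F}_m$ with $C\sim aS_+$ whose restriction to $\iota_m(\mathbb{A}^2)$ is the divisor of $F$. An effective divisor is irreducible if it is nonzero and not the sum of two nonzero effective divisors. A curve (possibly non-reduced) on a smooth surface has a singularity of type $A_k$ at a point $s$ if in suitable local analytic coordinates centred at $s$ it is given by the equation $y^2-x^{k+1}=0$, i.e. a local equation of the curve is a unit times $y^2-x^{k+1}$. "At most a singularity of type $A_N$"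 means that $k\le N$ whenever there is a point with a singularity of type $A_k$. Statement. Let $m\geq 2$ be an integer, let $r\in\{0,1,2\}$, and let $F\in\mathbb{C}[x,y]$ be a nonzero polynomial of bidegree $(3,3m-r)$. Then $F$ has exactly one $(3,3m)$-divisor $C\subset\mathbb{F}_m$, and: 1. either $C$ is irreducible, or $C$ (at every point of $\mathbb{F}_m$), and therefore also the curve $F=0$ in $\mathbb{A}^2$, has at most a singularity of type $A_{4m-1-r}$; 2. either $F$ is irreducible in $\mathbb{C}[x,y]$, or the curve $F=0$ in $\mathbb{A}^2$ has at most a singularity of type $A_{4m-1-r}$. Equivalently, if $F=0$ has a singularity of type $A_k$ with $k>4m-1-r$, then $F$ is irreducible. -/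

import Mathlib

open Topology

noncomputable section

namespace Hirzebruch

/-- The ring `ℂ[x, y]`, with `x` the variable `0` and `y` the variable `1`. -/
abbrev Poly : Type := MvPolynomial (Fin 2) ℂ

/-- The Newton polygon of `F`: the convex hull of the exponents of its monomials. -/
def newtonPolygon (F : Poly) : Set (ℝ × ℝ) :=
  convexHull ℝ {p : ℝ × ℝ | ∃ e ∈ F.support, p = ((e 0 : ℝ), (e 1 : ℝ))}

/-- `F` has bidegree `(a, b)`: its Newton polygon lies in the triangle spanned by
`(a, 0)`, `(0, 0)` and `(0, b)`. -/
def HasBidegree (a b : ℕ) (F : Poly) : Prop :=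
  newtonPolygon F ⊆ convexHull ℝ {((a : ℝ), (0 : ℝ)), (0, 0), (0, (b : ℝ))}

/-- The curve `f = 0` in the complex plane has a singularity of type `A_k` at `s`: in suitable
local analytic coordinates `e`, centred at `s`, it is given by `y ^ 2 - x ^ (k + 1) = 0`, that is,
`f` is the product of `y ^ 2 - x ^ (k + 1)` and an analytic function which does not vanish
at `s`. -/
def IsSingularityA (k : ℕ) (f : Poly) (s : Fin 2 → ℂ) : Prop :=
  ∃ (e : OpenPartialHomeomorph (Fin 2 → ℂ) (Fin 2 → ℂ)) (h : (Fin 2 → ℂ) → ℂ),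
    s ∈ e.source ∧ e s = 0 ∧ AnalyticAt ℂ e s ∧ AnalyticAt ℂ e.symm 0 ∧
    AnalyticAt ℂ h s ∧ h s ≠ 0 ∧
    ∀ᶠ z in 𝓝 s, MvPolynomial.eval z f = h z * ((e z 1) ^ 2 - (e z 0) ^ (k + 1))

/-- The plane without the origin. -/
abbrev PuncturedPlane : Type := {v : Fin 2 → ℂ // v ≠ 0}

/-- Two pairs `((x₀, x₁), (y₀, y₁))` and `((x₀', x₁'), (y₀', y₁'))` represent the same point of
the `m`-th Hirzebruch surface if the first is `((μ x₀', λ⁻ᵐ μ x₁'), (λ y₀', λ y₁'))` for some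
nonzero complex numbers `λ`, `μ` (here `l` and `u`). -/
def surfaceSetoid (m : ℕ) : Setoid (PuncturedPlane × PuncturedPlane) where
  r p q := ∃ l u : ℂ, l ≠ 0 ∧ u ≠ 0 ∧
    p.1.1 0 = u * q.1.1 0 ∧ p.1.1 1 = (l ^ m)⁻¹ * u * q.1.1 1 ∧
    p.2.1 0 = l * q.2.1 0 ∧ p.2.1 1 = l * q.2.1 1
  iseqv :=
    { refl := fun p => ⟨1, 1, one_ne_zero, one_ne_zero, by simp, by simp, by simp, by simp⟩
      symm := by
        rintro p q ⟨l, u, hl, hu, h0, h1, h2, h3⟩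
        refine ⟨l⁻¹, u⁻¹, inv_ne_zero hl, inv_ne_zero hu, ?_, ?_, ?_, ?_⟩
        · rw [h0]; field_simp
        · rw [h1, inv_pow]; field_simp
        · rw [h2]; field_simp
        · rw [h3]; field_simp
      trans := by
        rintro p q t ⟨l, u, hl, hu, h0, h1, h2, h3⟩ ⟨l', u', hl', hu', h0', h1', h2', h3'⟩
        refine ⟨l * l', u * u', mul_ne_zero hl hl', mul_ne_zero hu hu', ?_, ?_, ?_, ?_⟩
        · rw [h0, h0']; ring
        · rw [h1, h1', mul_pow, mul_inv]; ring
        · rw [h2, h2']; ring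
        · rw [h3, h3']; ring }

/-- The set of points of the `m`-th Hirzebruch surface `𝔽_m`. -/
def Surface (m : ℕ) : Type := Quotient (surfaceSetoid m)

/-- The point `[x₀ : x₁ ; y₀ : y₁]` of `𝔽_m`. -/
def Surface.mk (m : ℕ) (x y : PuncturedPlane) : Surface m :=
  Quotient.mk (surfaceSetoid m) (x, y)

/-- The vector `(z, 1)`. -/
def toOne (z : ℂ) : PuncturedPlane := ⟨![z, 1], fun h => one_ne_zero (congrFun h 1)⟩

/-- The vector `(1, z)`. -/
def oneTo (z : ℂ) : PuncturedPlane := ⟨![1, z], fun h => one_ne_zero (congrFun h 0)⟩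

/-- The four standard affine charts of `𝔽_m`: `xiyj` is the open set `x_i ≠ 0, y_j ≠ 0`. -/
inductive Chart : Type
  | x1y1
  | x1y0
  | x0y1
  | x0y0

/-- The parametrization of a chart by the affine plane. For `x1y1` it is the embedding
`ι_m : (x, y) ↦ [x : 1 ; y : 1]`. -/
def chartPoint (m : ℕ) : Chart → (Fin 2 → ℂ) → Surface m
  | .x1y1, z => Surface.mk m (toOne (z 0)) (toOne (z 1))
  | .x1y0, z => Surface.mk m (toOne (z 0)) (oneTo (z 1))
  | .x0y1, z => Surface.mk m (oneTo (z 0)) (toOne (z 1))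
  | .x0y0, z => Surface.mk m (oneTo (z 0)) (oneTo (z 1))

/-- The field `ℂ(x, y)`, which is the function field of `𝔽_m` through the chart
`ι_m : (x, y) ↦ [x : 1 ; y : 1]`; thus `x = x₀ / (x₁ y₁ᵐ)` and `y = y₀ / y₁`. -/
abbrev FunctionField : Type := FractionRing Poly

/-- The rational function `x`. -/
def fx : FunctionField := algebraMap Poly FunctionField (MvPolynomial.X 0)

/-- The rational function `y`. -/
def fy : FunctionField := algebraMap Poly FunctionField (MvPolynomial.X 1)

/-- The two coordinate functions of a chart as rational functions on `𝔽_m`: in homogeneous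
coordinates these are, in the order of the cases,
`(x₀ / (x₁ y₁ᵐ), y₀ / y₁)`, `(x₀ / (x₁ y₀ᵐ), y₁ / y₀)`,
`(x₁ y₁ᵐ / x₀, y₀ / y₁)`, `(x₁ y₀ᵐ / x₀, y₁ / y₀)`. -/
def coord (m : ℕ) : Chart → Fin 2 → FunctionField
  | .x1y1 => ![fx, fy]
  | .x1y0 => ![fx / fy ^ m, fy⁻¹]
  | .x0y1 => ![fx⁻¹, fy]
  | .x0y0 => ![fy ^ m / fx, fy⁻¹]

/-- A polynomial in the coordinates of a chart, as a rational function on `𝔽_m`. -/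
def toFun (m : ℕ) (c : Chart) : Poly →ₐ[ℂ] FunctionField := MvPolynomial.aeval (coord m c)

/-- The ring of regular functions on the intersection of two charts. -/
def overlapRing (m : ℕ) (c d : Chart) : Subalgebra ℂ FunctionField :=
  Algebra.adjoin ℂ (Set.range (coord m c) ∪ Set.range (coord m d))

/-- The effective (Cartier) divisors on `𝔽_m`: on each chart, which is an affine plane, a nonzero
polynomial up to a nonzero constant factor (the local equation of the divisor), such that on the
intersection of any two charts the local equations differ by an invertible regular function.
The monoid is written multiplicatively: the product of local equations is the local equation of
the sum of the divisors, and `1` is the zero divisor. -/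
def effectiveDivisors (m : ℕ) : Submonoid (Chart → Associates Poly) where
  carrier := {D | ∃ p : Chart → Poly, (∀ c, p c ≠ 0 ∧ Associates.mk (p c) = D c) ∧
    ∀ c d, ∃ v : (overlapRing m c d)ˣ, toFun m c (p c) = (v : FunctionField) * toFun m d (p d)}
  one_mem' := ⟨fun _ => 1, fun _ => ⟨one_ne_zero, rfl⟩, fun _ _ => ⟨1, by simp⟩⟩
  mul_mem' := by
    rintro D E ⟨p, hp, hp'⟩ ⟨q, hq, hq'⟩
    refine ⟨fun c => p c * q c, fun c => ⟨mul_ne_zero (hp c).1 (hq c).1, ?_⟩, fun c d => ?_⟩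
    · rw [← Associates.mk_mul_mk, (hp c).2, (hq c).2]; rfl
    · obtain ⟨v, hv⟩ := hp' c d
      obtain ⟨w, hw⟩ := hq' c d
      refine ⟨v * w, ?_⟩
      rw [map_mul, map_mul, hv, hw]
      push_cast
      ring

/-- An effective divisor on `𝔽_m`. Since the monoid is multiplicative, Mathlib's `Irreducible`
says that the divisor is nonzero and not the sum of two nonzero effective divisors. -/
abbrev EffectiveDivisor (m : ℕ) : Type := effectiveDivisors m

/-- The local equation, up to a nonzero constant, of the divisor `D` on the chart `c`. -/
def EffectiveDivisor.localEq {m : ℕ} (D : EffectiveDivisor m) (c : Chart) : Associates Poly :=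
  D.1 c

/-- The local equations of the section `x₀ = 0`. -/
def sPlusEq : Chart → Poly
  | .x1y1 => MvPolynomial.X 0
  | .x1y0 => MvPolynomial.X 0
  | .x0y1 => 1
  | .x0y0 => 1

theorem fx_ne_zero : fx ≠ 0 := by
  simp [fx, MvPolynomial.X_ne_zero]

theorem fy_ne_zero : fy ≠ 0 := by
  simp [fy, MvPolynomial.X_ne_zero]

theorem overlapRing_comm (m : ℕ) (c d : Chart) : overlapRing m c d = overlapRing m d c := by
  rw [overlapRing, overlapRing, Set.union_comm]

theorem toFun_sPlusEq_ne_zero (m : ℕ) (c : Chart) : toFun m c (sPlusEq c) ≠ 0 := by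
  have hx := fx_ne_zero
  have hy := fy_ne_zero
  cases c <;> simp [toFun, sPlusEq, coord, hx, hy]

theorem toFun_sPlusEq_div_mem (m : ℕ) (c d : Chart) :
    toFun m c (sPlusEq c) / toFun m d (sPlusEq d) ∈ overlapRing m c d := by
  have hx := fx_ne_zero
  have hy := fy_ne_zero
  have hl : ∀ i, coord m c i ∈ overlapRing m c d :=
    fun i => Algebra.subset_adjoin (Or.inl ⟨i, rfl⟩)
  have hr : ∀ i, coord m d i ∈ overlapRing m c d :=
    fun i => Algebra.subset_adjoin (Or.inr ⟨i, rfl⟩)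
  have l0 := hl 0
  have l1 := hl 1
  have r0 := hr 0
  have r1 := hr 1
  have l1m := pow_mem l1 m
  have r1m := pow_mem r1 m
  have h1 := one_mem (overlapRing m c d)
  have hlr := mul_mem r0 l1m
  have hll := mul_mem l0 l1m
  generalize overlapRing m c d = S at *
  cases c <;> cases d <;>
    simp only [toFun, sPlusEq, coord, map_one, MvPolynomial.aeval_X, Matrix.cons_val_zero,
      Matrix.cons_val_one, div_one, inv_pow, one_div, inv_div] at * <;>
    first
    | assumption
    | (convert h1 using 1; field_simp; done)
    | (convert l0 using 1; field_simp; done)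
    | (convert l1m using 1; field_simp; done)
    | (convert hlr using 1; field_simp; done)
    | (convert hll using 1; field_simp; done)

/-- The section `S₊` of `𝔽_m`, given by `x₀ = 0`, as an effective divisor. -/
def sPlus (m : ℕ) : EffectiveDivisor m :=
  ⟨fun c => Associates.mk (sPlusEq c), sPlusEq,
    fun c => ⟨fun h => toFun_sPlusEq_ne_zero m c (by rw [h, map_zero]), rfl⟩, fun c d => by
      have hc := toFun_sPlusEq_ne_zero m c
      have hd := toFun_sPlusEq_ne_zero m d
      refine ⟨⟨⟨_, toFun_sPlusEq_div_mem m c d⟩,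
        ⟨_, overlapRing_comm m c d ▸ toFun_sPlusEq_div_mem m d c⟩, ?_, ?_⟩, ?_⟩
      · apply Subtype.ext
        simp only [MulMemClass.mk_mul_mk, OneMemClass.coe_one]
        field_simp
      · apply Subtype.ext
        simp only [MulMemClass.mk_mul_mk, OneMemClass.coe_one]
        field_simp
      · simp only
        field_simp⟩

/-- Linear equivalence of effective divisors: `C - D` is the divisor of a nonzero rational
function `g`, that is, on every chart the local equation of `C` is `g` times that of `D`. -/
def LinearlyEquivalent {m : ℕ} (C D : EffectiveDivisor m) : Prop :=
  ∃ g : FunctionField, g ≠ 0 ∧ ∀ c, ∃ p q : Poly,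
    Associates.mk p = C.localEq c ∧ Associates.mk q = D.localEq c ∧
    toFun m c p = g * toFun m c q

/-- `C` is an `(a, am)`-divisor of the polynomial `F`: it is linearly equivalent to `a S₊`
(in multiplicative notation, `S₊ ^ a`), and its restriction to the image of `ι_m` is the divisor
of `F`. -/
def IsDivisorOf {m : ℕ} (a : ℕ) (F : Poly) (C : EffectiveDivisor m) : Prop :=
  LinearlyEquivalent C (sPlus m ^ a) ∧ C.localEq .x1y1 = Associates.mk F

/-- The divisor `C` has a singularity of type `A_k` at the point `s` of `𝔽_m`: in some chart
around `s`, a local equation of `C` has such a singularity at the coordinates of `s`. -/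
def EffectiveDivisor.HasSingularityA {m : ℕ} (C : EffectiveDivisor m) (k : ℕ) (s : Surface m) :
    Prop :=
  ∃ (c : Chart) (z : Fin 2 → ℂ) (f : Poly), chartPoint m c z = s ∧
    Associates.mk f = C.localEq c ∧ IsSingularityA k f z

end Hirzebruch

end

/-!
A polynomial of bidegree `(3, 3m - r)` is `F = c x³ + a₁(y) x² + a₂(y) x + a₃(y)` with
`deg aᵢ ≤ i m - r i / 3`. Its divisor `C` is obtained by homogenizing: the local equation in the
other charts replaces `x` by `1 / x` and `aᵢ(y)` by `yⁱᵐ aᵢ(1 / y)` (`chartEq`). These equations are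
those of `3 S₊` times the rational function `F / x³` (`toFun_chartEq`), and since the coordinates of
each chart are algebraically independent (`toFun_injective`), no other divisor has the required
properties (`IsDivisorOf.localEq_eq`).

If `c ≠ 0` and `F` is irreducible, then `C` contains neither the negative section nor the fibre at
infinity, so it is irreducible (`IsDivisorOf.irreducible`). There remain two cases.

* If `c = 0`, then `C` is the sum of the negative section and of the closure of the curve
  `a₁ x² + a₂ x + a₃ = 0` (`IsSingularityA.le_of_chartEq_zero`). They meet with multiplicity at most
  `m`, and the singularities of the second curve are bounded by the order of vanishing of
  the discriminant `a₂² - 4 a₁ a₃`, whose degree is at most `4m - r`.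
* If `c ≠ 0` and `F` is reducible, then `F = c (x - p)(x² + q x + s)`, and the degrees of `p`, `q`,
  `s` obey the same bounds (`exists_factorization_of_not_irreducible`). The graph `x = p(y)` meets the
  other curve with multiplicity the order of vanishing of `p² + q p + s`, which is at most `2m - r`
  away from the fibre at infinity (`IsSingularityA.le_of_chartEq_factorization`). For `r ≥ 1`, the
  singular point on that fibre is a node or has multiplicity three.

Three facts bound `k` at a singularity of type `A_k` from above. Two components, one of them smooth,
meet there with multiplicity at least `(k + 1) / 2`
(`IsSingularityA.le_two_mul_rootMultiplicity`): on the smooth one the normal form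
`Y ^ 2 - X ^ (k + 1)` vanishes, so its gradient is `O(|X| ^ ((k + 1) / 2))`. Along the arc `Y = 0`
of the normal form, the equation vanishes to order `k + 1` and its gradient to order `k`
(`IsSingularityA.exists_arc`), so that the discriminant of a quadratic equation in `x` vanishes to
order `k + 1` (`IsSingularityA.le_rootMultiplicity_discr`). The multiplicity is at most two
(`IsSingularityA.not_isBigO_cube`).
-/

noncomputable section

namespace Hirzebruch

open MvPolynomial Filter Asymptotics

/-! ### Local analysis of singularities of type `A_k` -/

theorem isBigO_of_eventually_eq_mul {E : Type*} [Norm E] {f a b : ℂ → ℂ} {c : ℂ → E} {L : ℂ}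
    (ha : Tendsto a (𝓝 0) (𝓝 L)) (h : ∀ᶠ t in 𝓝 0, f t = a t * b t) (hb : b =O[𝓝 0] c) :
    f =O[𝓝 0] c := by
  have h1 : (fun t => a t * b t) =O[𝓝 0] b := by
    simpa using (ha.isBigO_one ℂ).mul (isBigO_refl b (𝓝 0))
  exact (h1.trans hb).congr' (h.mono fun t ht => ht.symm) EventuallyEq.rfl

theorem le_of_isBigO_pow {n k : ℕ} (h : (fun t : ℂ => t ^ n) =O[𝓝 0] fun t : ℂ => t ^ k) :
    k ≤ n := by
  by_contra! hnk
  have h1 : (fun t : ℂ => t ^ k) =o[𝓝[≠] 0] fun t : ℂ => t ^ n :=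
    (isLittleO_pow_pow hnk).mono nhdsWithin_le_nhds
  have h2 := (h.mono nhdsWithin_le_nhds).trans_isLittleO h1
  refine isLittleO_irrefl (Eventually.frequently ?_) h2
  filter_upwards [self_mem_nhdsWithin] with t ht using pow_ne_zero n ht

theorem isBigO_pow_pow_of_le {n k : ℕ} (h : n ≤ k) :
    (fun t : ℂ => t ^ k) =O[𝓝 0] fun t : ℂ => t ^ n := by
  rcases h.eq_or_lt with rfl | h
  · exact isBigO_refl _ _
  · exact (isLittleO_pow_pow h).isBigO

theorem hasFDerivAt_eval {𝕜 : Type*} [NontriviallyNormedField 𝕜] (f : MvPolynomial (Fin 2) 𝕜)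
    (z : Fin 2 → 𝕜) :
    HasFDerivAt (fun w : Fin 2 → 𝕜 => eval w f)
      (∑ i, eval z (pderiv i f) • ContinuousLinearMap.proj (R := 𝕜) (φ := fun _ : Fin 2 => 𝕜) i)
      z := by
  induction f using MvPolynomial.induction_on with
  | C a =>
    simp only [eval_C]
    refine (hasFDerivAt_const (𝕜 := 𝕜) a z).congr_fderiv ?_
    ext v
    simp
  | add p q hp hq =>
    simp only [map_add]
    refine (hp.fun_add hq).congr_fderiv ?_
    ext v
    simp
    ring
  | mul_X p j hp =>
    have hj : HasFDerivAt (fun w : Fin 2 → 𝕜 => w j)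
        (ContinuousLinearMap.proj (R := 𝕜) (φ := fun _ : Fin 2 => 𝕜) j) z :=
      (ContinuousLinearMap.proj (R := 𝕜) (φ := fun _ : Fin 2 => 𝕜) j).hasFDerivAt
    have h := hp.fun_mul hj
    simp only [map_mul, eval_X]
    refine h.congr_fderiv ?_
    ext v
    fin_cases j <;>
      simp [Derivation.leibniz, pderiv_X, Pi.single_apply] <;> ring

theorem fderiv_eval_single (f : Poly) (z : Fin 2 → ℂ) (i : Fin 2) :
    fderiv ℂ (fun w : Fin 2 → ℂ => eval w f) z (Pi.single i 1) = eval z (pderiv i f) := by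
  rw [(hasFDerivAt_eval f z).fderiv]
  fin_cases i <;> simp

theorem continuous_eval_poly (f : Poly) : Continuous fun w : Fin 2 → ℂ => eval w f :=
  continuous_iff_continuousAt.2 fun z => (hasFDerivAt_eval f z).continuousAt

/-- The normal form of an `A_k` singularity with coordinate functions `X`, `Y` and a local inverse
`g` of `(X, Y)`, together with the partial derivatives of the normal form. -/
theorem IsSingularityA.exists_normalForm {k : ℕ} {f : Poly} {s : Fin 2 → ℂ}
    (hf : IsSingularityA k f s) :
    ∃ (u X Y : (Fin 2 → ℂ) → ℂ) (g : (Fin 2 → ℂ) → (Fin 2 → ℂ)),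
      AnalyticAt ℂ u s ∧ AnalyticAt ℂ X s ∧ AnalyticAt ℂ Y s ∧ AnalyticAt ℂ g 0 ∧
      u s ≠ 0 ∧ X s = 0 ∧ Y s = 0 ∧ g 0 = s ∧
      (∀ᶠ w in 𝓝 (0 : Fin 2 → ℂ), X (g w) = w 0 ∧ Y (g w) = w 1) ∧
      (∀ᶠ z in 𝓝 s, g ![X z, Y z] = z) ∧
      (∀ᶠ z in 𝓝 s, eval z f = u z * (Y z ^ 2 - X z ^ (k + 1))) ∧
      (∀ᶠ z in 𝓝 s, ∀ i, eval z (pderiv i f) =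
        fderiv ℂ u z (Pi.single i 1) * (Y z ^ 2 - X z ^ (k + 1)) +
        u z * (2 * Y z * fderiv ℂ Y z (Pi.single i 1) -
          (k + 1) * X z ^ k * fderiv ℂ X z (Pi.single i 1))) := by
  obtain ⟨e, u, hs, hes, he, he', hu, hus, hfe⟩ := hf
  have hX : AnalyticAt ℂ (fun z => e z 0) s :=
    ((ContinuousLinearMap.proj (R := ℂ) (φ := fun _ : Fin 2 => ℂ) 0).analyticAt _).comp he
  have hY : AnalyticAt ℂ (fun z => e z 1) s :=
    ((ContinuousLinearMap.proj (R := ℂ) (φ := fun _ : Fin 2 => ℂ) 1).analyticAt _).comp he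
  have h0 : (0 : Fin 2 → ℂ) ∈ e.target := hes ▸ e.map_source hs
  refine ⟨u, fun z => e z 0, fun z => e z 1, e.symm, hu, hX, hY, he', hus, by simp [hes],
    by simp [hes], by rw [← hes, e.left_inv hs], ?_, ?_, hfe, ?_⟩
  · filter_upwards [e.open_target.mem_nhds h0] with w hw
    simp [e.right_inv hw]
  · filter_upwards [e.open_source.mem_nhds hs] with z hz
    convert e.left_inv hz using 2
    ext i
    fin_cases i <;> rfl
  · filter_upwards [hfe.eventually_nhds, hu.eventually_analyticAt, hX.eventually_analyticAt,
      hY.eventually_analyticAt] with z hz hu hX hY i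
    have hu' := hu.differentiableAt.hasFDerivAt
    have hX' := hX.differentiableAt.hasFDerivAt
    have hY' := hY.differentiableAt.hasFDerivAt
    have h := hu'.fun_mul ((hY'.pow 2).fun_sub (hX'.pow (k + 1)))
    rw [← fderiv_eval_single, Filter.EventuallyEq.fderiv_eq hz, h.fderiv]
    simp
    ring

theorem IsSingularityA.eval_eq_zero {k : ℕ} {f : Poly} {s : Fin 2 → ℂ}
    (hf : IsSingularityA k f s) : eval s f = 0 := by
  obtain ⟨e, u, -, hes, -, -, -, -, hfe⟩ := hf
  simp [hfe.self_of_nhds, hes]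

/-- Removing a factor which does not vanish at the point does not change the singularity. -/
theorem IsSingularityA.of_mul_left {k : ℕ} {f g : Poly} {s : Fin 2 → ℂ}
    (hf : IsSingularityA k (f * g) s) (h : eval s f ≠ 0) : IsSingularityA k g s := by
  obtain ⟨e, u, hs, hes, he, he', hu, hus, hfe⟩ := hf
  have hfa : AnalyticAt ℂ (fun z : Fin 2 → ℂ => eval z f) s := by
    have := AnalyticOnNhd.eval_mvPolynomial (𝕜 := ℂ) f
    exact this s (Set.mem_univ s)
  refine ⟨e, fun z => u z / eval z f, hs, hes, he, he', hu.div hfa h, div_ne_zero hus h, ?_⟩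
  filter_upwards [hfe, hfa.continuousAt.eventually_ne h] with z hz hz'
  rw [div_mul_eq_mul_div, eq_div_iff hz', ← hz, map_mul, mul_comm]

/-- A point of type `A_k` is isolated among the singular points of the curve. -/
theorem IsSingularityA.eventually_eq_of_pderiv_eq_zero {k : ℕ} {f : Poly} {s : Fin 2 → ℂ}
    (hf : IsSingularityA k f s) :
    ∀ᶠ z in 𝓝 s, eval z f = 0 → (∀ i, eval z (pderiv i f) = 0) → z = s := by
  obtain ⟨u, X, Y, g, hu, hX, hY, hg, hus, hXs, hYs, hgs, hXY, hgXY, hfe, hfd⟩ :=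
    hf.exists_normalForm
  have hc : ContinuousAt (fun z => ![X z, Y z]) s := by
    refine continuousAt_pi.2 fun i => ?_
    fin_cases i
    · exact hX.continuousAt
    · exact hY.continuousAt
  have hc0 : Tendsto (fun z => ![X z, Y z]) (𝓝 s) (𝓝 0) := by
    have : ![X s, Y s] = 0 := by simp [hXs, hYs]
    simpa only [ContinuousAt, this] using hc
  filter_upwards [hc0.eventually (hXY.eventually_nhds.and hg.eventually_analyticAt), hgXY, hfe,
    hfd, hu.continuousAt.eventually_ne hus, hX.eventually_analyticAt,
    hY.eventually_analyticAt] with z ⟨hw, hgw⟩ hgz hfz hdz huz hXz hYz h0 hd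
  -- A tangent vector on which `dX` vanishes and `dY` is `1`.
  have hg' := hgw.differentiableAt.hasFDerivAt
  rw [← hgz] at hXz hYz
  have e1 : fderiv ℂ X z (fderiv ℂ g ![X z, Y z] (Pi.single 1 1)) = 0 := by
    have h1 := hXz.differentiableAt.hasFDerivAt.comp _ hg'
    have h2 : HasFDerivAt (X ∘ g) (ContinuousLinearMap.proj (R := ℂ) (φ := fun _ : Fin 2 => ℂ) 0)
        ![X z, Y z] :=
      (ContinuousLinearMap.proj (R := ℂ) (φ := fun _ : Fin 2 => ℂ)
        0).hasFDerivAt.congr_of_eventuallyEq (hw.mono fun w hw => hw.1)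
    have h3 := congrArg (fun L => L (Pi.single 1 1)) (h1.unique h2)
    simpa [hgz] using h3
  have e2 : fderiv ℂ Y z (fderiv ℂ g ![X z, Y z] (Pi.single 1 1)) = 1 := by
    have h1 := hYz.differentiableAt.hasFDerivAt.comp _ hg'
    have h2 : HasFDerivAt (Y ∘ g) (ContinuousLinearMap.proj (R := ℂ) (φ := fun _ : Fin 2 => ℂ) 1)
        ![X z, Y z] :=
      (ContinuousLinearMap.proj (R := ℂ) (φ := fun _ : Fin 2 => ℂ)
        1).hasFDerivAt.congr_of_eventuallyEq (hw.mono fun w hw => hw.2)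
    have h3 := congrArg (fun L => L (Pi.single 1 1)) (h1.unique h2)
    simpa [hgz] using h3
  set v := fderiv ℂ g ![X z, Y z] (Pi.single 1 1) with hv
  have hv' : v = v 0 • Pi.single 0 1 + v 1 • Pi.single 1 1 := by
    ext i
    fin_cases i <;> simp
  have hq : Y z ^ 2 - X z ^ (k + 1) = 0 := by
    rw [h0] at hfz
    exact (mul_eq_zero.1 hfz.symm).resolve_left huz
  have d0 := hdz 0
  have d1 := hdz 1
  rw [hd, hq, mul_zero, zero_add, eq_comm, mul_eq_zero, or_iff_right huz] at d0 d1
  rw [hv', map_add, map_smul, map_smul, smul_eq_mul, smul_eq_mul] at e1 e2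
  have hY0 : Y z = 0 := by
    linear_combination (v 0 / 2) * d0 + (v 1 / 2) * d1 + ((k + 1) * X z ^ k / 2) * e1 - Y z * e2
  have hX0 : X z = 0 := by
    rw [hY0] at hq
    have : X z ^ (k + 1) = 0 := by linear_combination -hq
    exact pow_eq_zero_iff (Nat.succ_ne_zero k) |>.1 this
  rw [← hgz, hX0, hY0, ← hgs]
  congr 1
  ext i
  fin_cases i <;> rfl

/-- Through an `A_k` singularity there is a smooth arc, the axis `Y = 0` of the normal form, along
which the equation vanishes to order exactly `k + 1` and its gradient to order at least `k`. -/
theorem IsSingularityA.exists_arc {k : ℕ} {f : Poly} {s : Fin 2 → ℂ} (hf : IsSingularityA k f s) :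
    ∃ (ψ : ℂ → Fin 2 → ℂ) (v : Fin 2 → ℂ), v ≠ 0 ∧ HasDerivAt ψ v 0 ∧ ψ 0 = s ∧
      (fun t => eval (ψ t) f) =O[𝓝 0] (fun t : ℂ => t ^ (k + 1)) ∧
      (fun t : ℂ => t ^ (k + 1)) =O[𝓝 0] (fun t => eval (ψ t) f) ∧
      ∀ i, (fun t => eval (ψ t) (pderiv i f)) =O[𝓝 0] (fun t : ℂ => t ^ k) := by
  obtain ⟨u, X, Y, g, hu, hX, hY, hg, hus, hXs, hYs, hgs, hXY, hgXY, hfe, hfd⟩ :=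
    hf.exists_normalForm
  have hι : HasDerivAt (fun t : ℂ => (Pi.single 0 t : Fin 2 → ℂ)) (Pi.single 0 1) 0 := by
    refine hasDerivAt_pi.2 fun i => ?_
    fin_cases i
    · simp only [Fin.zero_eta, Pi.single_eq_same]
      exact hasDerivAt_id' (0 : ℂ)
    · simpa using hasDerivAt_const (0 : ℂ) (0 : ℂ)
  have hι0 : Tendsto (fun t : ℂ => (Pi.single 0 t : Fin 2 → ℂ)) (𝓝 0) (𝓝 0) := by
    simpa [ContinuousAt] using hι.continuousAt
  have hgι : HasFDerivAt g (fderiv ℂ g 0) (Pi.single 0 (0 : ℂ)) := by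
    simpa using hg.differentiableAt.hasFDerivAt
  have hψ := hgι.comp_hasDerivAt 0 hι
  have hψ0 : Tendsto (fun t : ℂ => g (Pi.single 0 t)) (𝓝 0) (𝓝 s) := by
    have := hg.continuousAt.tendsto.comp hι0
    rwa [hgs] at this
  have hXY' := hι0.eventually hXY
  refine ⟨fun t => g (Pi.single 0 t), _, ?_, hψ, by simpa using hgs, ?_, ?_, ?_⟩
  · intro hv
    rw [hv] at hψ
    have hX' : HasFDerivAt X (fderiv ℂ X s) ((g ∘ fun t : ℂ => Pi.single 0 t) 0) := by
      simpa [hgs] using hX.differentiableAt.hasFDerivAt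
    have h1 := hX'.comp_hasDerivAt 0 hψ
    have h2 : HasDerivAt (X ∘ (g ∘ fun t : ℂ => Pi.single 0 t)) 1 0 :=
      (hasDerivAt_id (0 : ℂ)).congr_of_eventuallyEq (hXY'.mono fun t ht => by simpa using ht.1)
    simpa using h1.unique h2
  · refine isBigO_of_eventually_eq_mul (hu.continuousAt.tendsto.comp hψ0).neg ?_
      (isBigO_refl (fun t : ℂ => t ^ (k + 1)) (𝓝 0))
    filter_upwards [hψ0.eventually hfe, hXY'] with t ht hxy
    simp [ht, hxy.1, hxy.2]
  · refine isBigO_of_eventually_eq_mul ((hu.continuousAt.tendsto.comp hψ0).inv₀ hus).neg ?_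
      (isBigO_refl _ (𝓝 0))
    filter_upwards [hψ0.eventually hfe, hXY',
      hψ0.eventually (hu.continuousAt.eventually_ne hus)] with t ht hxy hut
    simp only [ht, hxy.1, hxy.2, Function.comp]
    simp
    field_simp
  · intro i
    have hu' := (hu.fderiv.continuousAt.clm_apply continuousAt_const).tendsto.comp
      (g := fun z => fderiv ℂ u z (Pi.single i 1)) hψ0
    have hX' := (hX.fderiv.continuousAt.clm_apply continuousAt_const).tendsto.comp
      (g := fun z => fderiv ℂ X z (Pi.single i 1)) hψ0
    have ht0 : Tendsto (fun t : ℂ => t) (𝓝 0) (𝓝 0) := tendsto_id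
    refine isBigO_of_eventually_eq_mul (((ht0.mul hu').add
      ((hu.continuousAt.tendsto.comp hψ0).mul (hX'.const_mul ((k : ℂ) + 1)))).neg) ?_
      (isBigO_refl (fun t : ℂ => t ^ k) (𝓝 0))
    filter_upwards [hψ0.eventually hfd, hXY'] with t ht hxy
    simp only [ht i, hxy.1, hxy.2, Function.comp]
    simp
    ring

/-- An `A_k` singularity has multiplicity at most `2`: its equation vanishes to order exactly `2`
along the axis `X = 0` of the normal form. -/
theorem IsSingularityA.not_isBigO_cube {k : ℕ} {f : Poly} {s : Fin 2 → ℂ}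
    (hf : IsSingularityA k f s)
    (h3 : (fun z => eval z f) =O[𝓝 s] (fun z => ‖z - s‖ ^ 3)) : False := by
  obtain ⟨u, X, Y, g, hu, hX, hY, hg, hus, hXs, hYs, hgs, hXY, hgXY, hfe, hfd⟩ :=
    hf.exists_normalForm
  have hι : HasDerivAt (fun t : ℂ => (Pi.single 1 t : Fin 2 → ℂ)) (Pi.single 1 1) 0 := by
    refine hasDerivAt_pi.2 fun i => ?_
    fin_cases i
    · simpa using hasDerivAt_const (0 : ℂ) (0 : ℂ)
    · simp only [Fin.mk_one, Pi.single_eq_same]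
      exact hasDerivAt_id' (0 : ℂ)
  have hι0 : Tendsto (fun t : ℂ => (Pi.single 1 t : Fin 2 → ℂ)) (𝓝 0) (𝓝 0) := by
    simpa [ContinuousAt] using hι.continuousAt
  have hgι : HasFDerivAt g (fderiv ℂ g 0) (Pi.single 1 (0 : ℂ)) := by
    simpa using hg.differentiableAt.hasFDerivAt
  have hψ := hgι.comp_hasDerivAt 0 hι
  have hψ0 : Tendsto (fun t : ℂ => g (Pi.single 1 t)) (𝓝 0) (𝓝 s) := by
    have := hg.continuousAt.tendsto.comp hι0
    rwa [hgs] at this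
  have hXY' := hι0.eventually hXY
  have h2 : (fun t : ℂ => t ^ 2) =O[𝓝 0] fun t => eval (g (Pi.single 1 t)) f := by
    refine isBigO_of_eventually_eq_mul ((hu.continuousAt.tendsto.comp hψ0).inv₀ hus) ?_
      (isBigO_refl _ (𝓝 0))
    filter_upwards [hψ0.eventually hfe, hXY',
      hψ0.eventually (hu.continuousAt.eventually_ne hus)] with t ht hxy hut
    simp only [ht, hxy.1, hxy.2, Function.comp]
    simp
    field_simp
  have h1 : (fun t : ℂ => ‖g (Pi.single 1 t) - s‖) =O[𝓝 0] fun t : ℂ => t := by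
    have := hψ.differentiableAt.isBigO_sub
    simpa [hgs] using this.norm_left
  have h4 := h2.trans ((h3.comp_tendsto hψ0).trans (h1.pow 3))
  exact absurd (le_of_isBigO_pow h4) (by norm_num)

/-- If `l * g = 0` has an `A_k` singularity, `φ` is a curve in `l = 0` and `l = 0` is smooth, then
`g` vanishes along `φ` to order at least `(k + 1) / 2`: on the curve `l = 0`, the normal form gives
`Y ^ 2 = X ^ (k + 1)`, and a partial derivative of `l * g` is a unit times `g`. -/
theorem IsSingularityA.isBigO_along_branch {k : ℕ} {l g : Poly} {s : Fin 2 → ℂ}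
    (hf : IsSingularityA k (l * g) s) (hk : 1 ≤ k) {φ : ℂ → Fin 2 → ℂ}
    (hφ : DifferentiableAt ℂ φ 0) (hφ0 : φ 0 = s) (hl : ∀ᶠ t in 𝓝 0, eval (φ t) l = 0)
    {i : Fin 2} (hi : eval s (pderiv i l) ≠ 0) :
    (fun t => eval (φ t) g ^ 2) =O[𝓝 0] (fun t : ℂ => t ^ (k + 1)) := by
  obtain ⟨u, X, Y, -, hu, hX, hY, -, hus, hXs, hYs, -, -, -, hfe, hfd⟩ := hf.exists_normalForm
  have hφt : Tendsto φ (𝓝 0) (𝓝 s) := hφ0 ▸ hφ.continuousAt.tendsto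
  have hYX : ∀ᶠ t in 𝓝 0, Y (φ t) ^ 2 = X (φ t) ^ (k + 1) := by
    filter_upwards [hl, hφt.eventually hfe,
      hφt.eventually (hu.continuousAt.eventually_ne hus)] with t h1 h2 h3
    rw [map_mul, h1, zero_mul, eq_comm, mul_eq_zero, or_iff_right h3] at h2
    linear_combination h2
  have hXO : (fun t => X (φ t)) =O[𝓝 0] fun t : ℂ => t := by
    have h1 : DifferentiableAt ℂ X (φ 0) := hφ0 ▸ hX.differentiableAt
    have h2 := (h1.comp 0 hφ).isBigO_sub
    simpa [hφ0, hXs, Function.comp_def] using h2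
  -- `T ^ 2 = |t| ^ (k + 1)` allows for an odd exponent `k + 1`.
  set T : ℂ → ℝ := fun t => Real.sqrt (‖t‖ ^ (k + 1)) with hT
  have hT2 : ∀ t, T t ^ 2 = ‖t‖ ^ (k + 1) := fun t => Real.sq_sqrt (by positivity)
  have hYO : (fun t => Y (φ t)) =O[𝓝 0] T := by
    refine IsBigO.of_pow two_ne_zero ?_
    refine (hXO.pow (k + 1)).norm_right.congr' (hYX.mono fun t ht => ht.symm)
      (Eventually.of_forall fun t => ?_)
    simp [hT2]
  have hXkO : (fun t => X (φ t) ^ k) =O[𝓝 0] T := by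
    refine IsBigO.of_pow two_ne_zero ?_
    have h1 : (fun t : ℂ => t ^ (2 * k)) =O[𝓝 0] fun t : ℂ => t ^ (k + 1) :=
      isBigO_pow_pow_of_le (by omega)
    refine ((hXO.pow (2 * k)).trans h1).norm_right.congr_left (fun t => ?_) |>.congr_right
      (fun t => ?_)
    · simp [← pow_mul, mul_comm]
    · simp [hT2]
  have hu' := hu.continuousAt.tendsto.comp hφt
  have hX' := (hX.fderiv.continuousAt.clm_apply continuousAt_const).tendsto.comp
    (g := fun z => fderiv ℂ X z (Pi.single i 1)) hφt
  have hY' := (hY.fderiv.continuousAt.clm_apply continuousAt_const).tendsto.comp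
    (g := fun z => fderiv ℂ Y z (Pi.single i 1)) hφt
  have hl' := (continuous_eval_poly (pderiv i l)).continuousAt.tendsto.comp hφt
  have hA : (fun t => 2 * u (φ t) * fderiv ℂ Y (φ t) (Pi.single i 1) * Y (φ t)) =O[𝓝 0] T :=
    isBigO_of_eventually_eq_mul ((hu'.const_mul 2).mul hY') (Eventually.of_forall fun t => rfl) hYO
  have hB : (fun t => (k + 1) * u (φ t) * fderiv ℂ X (φ t) (Pi.single i 1) * X (φ t) ^ k)
      =O[𝓝 0] T :=
    isBigO_of_eventually_eq_mul ((hu'.const_mul ((k : ℂ) + 1)).mul hX')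
      (Eventually.of_forall fun t => rfl) hXkO
  have hg : (fun t => eval (φ t) g) =O[𝓝 0] T := by
    refine isBigO_of_eventually_eq_mul (hl'.inv₀ hi) ?_ (hA.sub hB)
    filter_upwards [hφt.eventually hfd, hl, hYX, hl'.eventually_ne hi] with t h1 h2 h3 h4
    have h5 := h1 i
    rw [Derivation.leibniz] at h5
    simp only [smul_eq_mul, map_add, map_mul, h2, h3, sub_self, mul_zero, zero_mul,
      zero_add] at h5
    simp only [Function.comp] at h4 ⊢
    rw [eq_inv_mul_iff_mul_eq₀ h4]
    linear_combination h5
  refine (hg.pow 2).trans (IsBigO.of_norm_right ?_)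
  simp only [hT2, norm_pow]
  exact isBigO_refl _ _

/-- A curve with an `A_k` singularity is reduced there: two factors of its equation do not vanish
along the same nonconstant curve. -/
theorem IsSingularityA.not_eventually_eq_zero_along_branch {k : ℕ} {l g : Poly} {s : Fin 2 → ℂ}
    (hf : IsSingularityA k (l * g) s) {φ : ℂ → Fin 2 → ℂ}
    (hφ : ContinuousAt φ 0) (hφ0 : φ 0 = s) (hφs : ∃ᶠ t in 𝓝 0, φ t ≠ s)
    (hl : ∀ᶠ t in 𝓝 0, eval (φ t) l = 0) (hg : ∀ᶠ t in 𝓝 0, eval (φ t) g = 0) : False := by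
  have hφt : Tendsto φ (𝓝 0) (𝓝 s) := hφ0 ▸ hφ.tendsto
  refine hφs ?_
  filter_upwards [hφt.eventually hf.eventually_eq_of_pderiv_eq_zero, hl, hg] with t h1 h2 h3
  refine not_not.2 (h1 (by simp [h2]) fun i => ?_)
  simp [Derivation.leibniz, h2, h3]

theorem eq_zero_of_isBigO_pow {n : ℕ} (hn : n ≠ 0) {q : ℂ → ℂ}
    (h : q =O[𝓝 0] fun t : ℂ => t ^ n) : q 0 = 0 := by
  obtain ⟨c, hc⟩ := h.bound
  simpa [hn] using hc.self_of_nhds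

theorem eq_zero_of_hasDerivAt_of_isBigO_pow {n : ℕ} (hn : 2 ≤ n) {q : ℂ → ℂ} {d : ℂ}
    (hq : HasDerivAt q d 0) (h : q =O[𝓝 0] fun t : ℂ => t ^ n) : d = 0 := by
  refine hq.unique (hasDerivAt_iff_isLittleO.2 ?_)
  have h1 : (fun t : ℂ => t ^ n) =o[𝓝 0] fun t : ℂ => t := by
    simpa using isLittleO_pow_pow (𝕜 := ℂ) (show 1 < n by omega)
  simpa [eq_zero_of_isBigO_pow (by omega) h] using h.trans_isLittleO h1

theorem le_rootMultiplicity_of_isBigO {D : Polynomial ℂ} (hD : D ≠ 0) {y : ℂ → ℂ} {v : ℂ}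
    (hv : v ≠ 0) (hy : HasDerivAt y v 0) {n : ℕ}
    (h : (fun t => D.eval (y t)) =O[𝓝 0] fun t : ℂ => t ^ n) : n ≤ D.rootMultiplicity (y 0) := by
  obtain ⟨q, hq, hq0⟩ := D.exists_eq_pow_rootMultiplicity_mul_and_not_dvd hD (y 0)
  rw [Polynomial.dvd_iff_isRoot, Polynomial.IsRoot.def] at hq0
  have hqy : Tendsto (fun t => q.eval (y t)) (𝓝 0) (𝓝 (q.eval (y 0))) :=
    q.continuous.continuousAt.tendsto.comp hy.continuousAt
  have h1 : (fun t : ℂ => t) =O[𝓝 0] fun t => y t - y 0 := by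
    have := (hy.isTheta_sub hv).isBigO_symm
    simpa [Function.comp_def] using this
  refine le_of_isBigO_pow (((h1.pow (D.rootMultiplicity (y 0))).trans ?_).trans h)
  refine isBigO_of_eventually_eq_mul (hqy.inv₀ hq0) ?_ (isBigO_refl _ _)
  filter_upwards [hqy.eventually_ne hq0] with t ht
  conv_rhs => rw [hq]
  simp
  field_simp

/-- Intersection bound: let `l * g = 0` have an `A_k` singularity, `k ≥ 1`, on the smooth curve
`l = 0` with parametrization `φ`. If `g` pulls back to a unit times `G (y₀ + t)` then `k + 1` is at
most twice the multiplicity of the root `y₀` of `G`; in particular `G` is nonzero. -/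
theorem IsSingularityA.le_two_mul_rootMultiplicity {k : ℕ} {l g : Poly} {s : Fin 2 → ℂ}
    (hf : IsSingularityA k (l * g) s) (hk : 1 ≤ k) {φ : ℂ → Fin 2 → ℂ}
    (hφ : DifferentiableAt ℂ φ 0) (hφ0 : φ 0 = s) (hφs : ∀ t, t ≠ 0 → φ t ≠ s)
    (hl : ∀ᶠ t in 𝓝 0, eval (φ t) l = 0) (i : Fin 2) (hi : eval s (pderiv i l) ≠ 0)
    {G : Polynomial ℂ} {y₀ : ℂ} {U : ℂ → ℂ} {L : ℂ} (hU : Tendsto U (𝓝 0) (𝓝 L)) (hL : L ≠ 0)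
    (hG : ∀ᶠ t in 𝓝 0, eval (φ t) g = U t * G.eval (y₀ + t)) :
    G ≠ 0 ∧ k + 1 ≤ 2 * G.rootMultiplicity y₀ := by
  have hG0 : G ≠ 0 := by
    rintro rfl
    refine hf.not_eventually_eq_zero_along_branch hφ.continuousAt hφ0 ?_ hl (by simpa using hG)
    refine Frequently.filter_mono (Eventually.frequently ?_) (nhdsWithin_le_nhds (s := {0}ᶜ))
    filter_upwards [self_mem_nhdsWithin] with t ht using hφs t ht
  refine ⟨hG0, ?_⟩
  have h1 := hf.isBigO_along_branch hk hφ hφ0 hl hi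
  have h2 : (fun t => (G ^ 2).eval (y₀ + t)) =O[𝓝 0] fun t : ℂ => t ^ (k + 1) := by
    refine isBigO_of_eventually_eq_mul ((hU.inv₀ hL).pow 2) ?_ h1
    filter_upwards [hG, hU.eventually_ne hL] with t ht hUt
    rw [ht]
    simp
    field_simp
  have h3 : HasDerivAt (fun t : ℂ => y₀ + t) 1 0 := (hasDerivAt_id' (0 : ℂ)).const_add y₀
  have h4 := le_rootMultiplicity_of_isBigO (pow_ne_zero 2 hG0) one_ne_zero h3 h2
  rwa [add_zero, ← Polynomial.count_roots, Polynomial.roots_pow, Multiset.count_nsmul,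
    Polynomial.count_roots] at h4

/-! ### Curves of degree two and three over the base -/

/-- A polynomial in `y`, as a polynomial in `x` and `y`. -/
def inY : Polynomial ℂ →ₐ[ℂ] Poly := Polynomial.aeval (X 1)

@[simp] theorem eval_inY (a : Polynomial ℂ) (z : Fin 2 → ℂ) : eval z (inY a) = a.eval (z 1) := by
  induction a using Polynomial.induction_on' with
  | add p q hp hq => simp [hp, hq]
  | monomial n c => simp [inY]

@[simp] theorem pderiv_zero_inY (a : Polynomial ℂ) : pderiv 0 (inY a) = 0 := by
  induction a using Polynomial.induction_on' with
  | add p q hp hq => simp [hp, hq]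
  | monomial n c =>
    simp [inY, Derivation.leibniz, Derivation.leibniz_pow, pderiv_X, algebraMap_eq]

@[simp] theorem pderiv_one_inY (a : Polynomial ℂ) :
    pderiv 1 (inY a) = inY (Polynomial.derivative a) := by
  induction a using Polynomial.induction_on' with
  | add p q hp hq => simp [hp, hq]
  | monomial n c =>
    simp [inY, Derivation.leibniz, Derivation.leibniz_pow, pderiv_X, algebraMap_eq,
      Polynomial.derivative_monomial]
    ring

/-- The polynomial `a x² + b x + d` with coefficients in `ℂ[y]`. -/
def quadratic (a b d : Polynomial ℂ) : Poly := inY a * X 0 ^ 2 + inY b * X 0 + inY d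

/-- The polynomial `a₀ x³ + a₁ x² + a₂ x + a₃` with coefficients in `ℂ[y]`. -/
def cubic (a₀ a₁ a₂ a₃ : Polynomial ℂ) : Poly :=
  inY a₀ * X 0 ^ 3 + inY a₁ * X 0 ^ 2 + inY a₂ * X 0 + inY a₃

@[simp] theorem eval_quadratic (a b d : Polynomial ℂ) (z : Fin 2 → ℂ) : eval z (quadratic a b d) =
    a.eval (z 1) * z 0 ^ 2 + b.eval (z 1) * z 0 + d.eval (z 1) := by
  simp [quadratic]

theorem eval_pderiv_zero_quadratic (a b d : Polynomial ℂ) (z : Fin 2 → ℂ) :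
    eval z (pderiv 0 (quadratic a b d)) = 2 * a.eval (z 1) * z 0 + b.eval (z 1) := by
  simp [quadratic, Derivation.leibniz, Derivation.leibniz_pow, pderiv_X]
  ring

/-- The squared equation `(2 a x + b)² = (b² - 4 a d) + 4 a (a x² + b x + d)` bounds the type of a
singularity of a quadratic cover by the discriminant; if the leading coefficient vanishes at the
singular point, then the curve contains the vertical line through it. -/
theorem IsSingularityA.le_rootMultiplicity_discr {k : ℕ} {a b d : Polynomial ℂ} {s : Fin 2 → ℂ}
    (hf : IsSingularityA k (quadratic a b d) s) (hk : 4 ≤ k) :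
    a.eval (s 1) ≠ 0 ∧ b ^ 2 - 4 * a * d ≠ 0 ∧
      k + 1 ≤ (b ^ 2 - 4 * a * d).rootMultiplicity (s 1) := by
  obtain ⟨ψ, v, hv, hψ, hψ0, h1, h2, h3⟩ := hf.exists_arc
  have hψt : Tendsto ψ (𝓝 0) (𝓝 s) := hψ0 ▸ hψ.continuousAt.tendsto
  have ha : a.eval (s 1) ≠ 0 := by
    intro ha
    have hb : b.eval (s 1) = 0 := by
      have h4 := eq_zero_of_isBigO_pow (by omega) (h3 0)
      rw [hψ0, eval_pderiv_zero_quadratic] at h4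
      simpa [ha] using h4
    have hd : d.eval (s 1) = 0 := by
      have := hf.eval_eq_zero
      simpa [ha, hb] using this
    rw [← Polynomial.IsRoot.def, ← Polynomial.dvd_iff_isRoot] at ha hb hd
    obtain ⟨a, rfl⟩ := ha
    obtain ⟨b, rfl⟩ := hb
    obtain ⟨d, rfl⟩ := hd
    have hq : quadratic ((Polynomial.X - Polynomial.C (s 1)) * a)
        ((Polynomial.X - Polynomial.C (s 1)) * b) ((Polynomial.X - Polynomial.C (s 1)) * d) =
        inY (Polynomial.X - Polynomial.C (s 1)) * quadratic a b d := by
      simp only [quadratic, map_mul]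
      ring
    rw [hq] at hf
    set G : Polynomial ℂ := Polynomial.C (a.eval (s 1)) * Polynomial.X ^ 2 +
      Polynomial.C (b.eval (s 1)) * Polynomial.X + Polynomial.C (d.eval (s 1)) with hG
    -- The vertical line meets the residual curve with multiplicity at most `2`.
    have hφ : HasDerivAt (fun t : ℂ => ![s 0 + t, s 1]) ![1, 0] 0 := by
      refine hasDerivAt_pi.2 fun i => ?_
      fin_cases i
      · exact (hasDerivAt_id' (0 : ℂ)).const_add (s 0)
      · exact hasDerivAt_const (0 : ℂ) (s 1)
    obtain ⟨hG0, hm⟩ := hf.le_two_mul_rootMultiplicity (by omega) hφ.differentiableAt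
      (by ext i; fin_cases i <;> simp) (fun t ht h => ht (by simpa using congrFun h 0))
      (Eventually.of_forall fun t => by simp) 1 (by simp) (G := G) (y₀ := s 0)
      tendsto_const_nhds one_ne_zero (Eventually.of_forall fun t => by simp [hG])
    have hdeg : G.rootMultiplicity (s 0) ≤ 2 := by
      rw [← Polynomial.count_roots]
      refine (Multiset.count_le_card _ _).trans ((Polynomial.card_roots' _).trans ?_)
      rw [hG]
      compute_degree
    omega
  have hψ1 : HasDerivAt (fun t => ψ t 1) (v 1) 0 := (hasDerivAt_pi.1 hψ) 1
  have haψ : Tendsto (fun t => a.eval (ψ t 1)) (𝓝 0) (𝓝 (a.eval (s 1))) := by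
    have := (a.continuous.continuousAt.tendsto.comp hψ1.continuousAt)
    simpa only [hψ0, Function.comp_def] using this
  have hv1 : v 1 ≠ 0 := by
    intro hv1
    have hψ1' : HasDerivAt (fun t => ψ t 0) (v 0) 0 := (hasDerivAt_pi.1 hψ) 0
    have h4 := (((a.hasDerivAt (ψ 0 1)).comp 0 hψ1).const_mul 2).fun_mul hψ1'
    have h5 := h4.fun_add ((b.hasDerivAt (ψ 0 1)).comp 0 hψ1)
    have h6 := eq_zero_of_hasDerivAt_of_isBigO_pow (n := k) (by omega) h5
      ((h3 0).congr_left fun t => eval_pderiv_zero_quadratic _ _ _ _)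
    simp [hv1, hψ0, ha] at h6
    exact hv (by ext i; fin_cases i <;> simp [h6, hv1])
  have h4 : (fun t => eval (ψ t) (pderiv 0 (quadratic a b d)) ^ 2)
      =O[𝓝 0] fun t : ℂ => t ^ (2 * k) := by
    simpa [← pow_mul, mul_comm k 2] using (h3 0).pow 2
  have hD : b ^ 2 - 4 * a * d ≠ 0 := by
    intro hD
    have h5 : (fun t : ℂ => t ^ (k + 1)) =O[𝓝 0] fun t : ℂ => t ^ (2 * k) := by
      refine h2.trans ?_
      refine isBigO_of_eventually_eq_mul ((haψ.const_mul 4).inv₀ (mul_ne_zero (by norm_num) ha))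
        ?_ h4
      filter_upwards [haψ.eventually_ne ha] with t ht
      have h6 := congrArg (Polynomial.eval (ψ t 1)) hD
      simp at h6
      rw [eval_pderiv_zero_quadratic, eval_quadratic, eq_inv_mul_iff_mul_eq₀ (by simpa using ht)]
      linear_combination -h6
    have := le_of_isBigO_pow h5
    omega
  refine ⟨ha, hD, ?_⟩
  rw [← hψ0]
  refine le_rootMultiplicity_of_isBigO hD hv1 hψ1 ?_
  have h5 : (fun t => 4 * a.eval (ψ t 1) * eval (ψ t) (quadratic a b d))
      =O[𝓝 0] fun t : ℂ => t ^ (k + 1) :=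
    isBigO_of_eventually_eq_mul (haψ.const_mul 4) (Eventually.of_forall fun t => rfl) h1
  refine ((h4.trans (isBigO_pow_pow_of_le (by omega))).sub h5).congr_left fun t => ?_
  rw [eval_pderiv_zero_quadratic, eval_quadratic]
  simp
  ring

theorem rootMultiplicity_le_natDegree (D : Polynomial ℂ) (a : ℂ) :
    D.rootMultiplicity a ≤ D.natDegree := by
  rw [← Polynomial.count_roots]
  exact (Multiset.count_le_card _ _).trans (Polynomial.card_roots' _)

theorem rootMultiplicity_le_sub_of_X_pow_dvd {D : Polynomial ℂ} (hD : D ≠ 0) {N e : ℕ}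
    (hN : D.natDegree ≤ N) (he : Polynomial.X ^ e ∣ D) {a : ℂ} (ha : a ≠ 0) :
    D.rootMultiplicity a ≤ N - e := by
  obtain ⟨q, rfl⟩ := he
  have hq : q ≠ 0 := right_ne_zero_of_mul hD
  rw [Polynomial.rootMultiplicity_mul hD, Polynomial.rootMultiplicity_eq_zero (by simp [ha])]
  rw [Polynomial.natDegree_mul (pow_ne_zero _ Polynomial.X_ne_zero) hq,
    Polynomial.natDegree_X_pow] at hN
  have := rootMultiplicity_le_natDegree q a
  omega

/-! ### Singularities of reducible curves -/

theorem IsSingularityA.le_of_quadratic {m r k : ℕ} (hm : 2 ≤ m) (hr : r ≤ 2)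
    {a b d : Polynomial ℂ} {z : Fin 2 → ℂ}
    (hD : b ^ 2 - 4 * a * d ≠ 0 → a.eval (z 1) ≠ 0 →
      (b ^ 2 - 4 * a * d).rootMultiplicity (z 1) ≤ 4 * m - r)
    (hf : IsSingularityA k (quadratic a b d) z) : k ≤ 4 * m - 1 - r := by
  by_contra! hk
  obtain ⟨ha, hd, hkD⟩ := hf.le_rootMultiplicity_discr (by omega)
  have := hD hd ha
  omega

/-- The line `x = 0` meets the residual curve `d x² + b x + a = 0` at `(0, y₀)` with multiplicity
the order of vanishing of `a` at `y₀`, which is at most `m`. -/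
theorem IsSingularityA.le_of_X_mul_quadratic {m r k : ℕ} (hm : 2 ≤ m) (hr : r ≤ 2)
    {a b d : Polynomial ℂ} {z : Fin 2 → ℂ} (ha : a.natDegree ≤ m)
    (hD : b ^ 2 - 4 * d * a ≠ 0 → d.eval (z 1) ≠ 0 →
      (b ^ 2 - 4 * d * a).rootMultiplicity (z 1) ≤ 4 * m - r)
    (hf : IsSingularityA k (X 0 * quadratic d b a) z) : k ≤ 4 * m - 1 - r := by
  by_cases hz : z 0 = 0
  · by_contra! hk
    have hφ : HasDerivAt (fun t : ℂ => ![0, z 1 + t]) ![0, 1] 0 := by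
      refine hasDerivAt_pi.2 fun i => ?_
      fin_cases i
      · exact hasDerivAt_const (0 : ℂ) 0
      · exact (hasDerivAt_id' (0 : ℂ)).const_add (z 1)
    obtain ⟨-, h⟩ := hf.le_two_mul_rootMultiplicity (by omega) hφ.differentiableAt
      (by ext i; fin_cases i <;> simp [hz]) (fun t ht h => ht (by simpa using congrFun h 1))
      (Eventually.of_forall fun t => by simp) 0 (by simp) (G := a) (y₀ := z 1)
      tendsto_const_nhds one_ne_zero (Eventually.of_forall fun t => by simp)
    have := rootMultiplicity_le_natDegree a (z 1)
    omega
  · exact (hf.of_mul_left (by simpa using hz)).le_of_quadratic hm hr hD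

theorem hasDerivAt_graph (p : Polynomial ℂ) (y₀ : ℂ) :
    HasDerivAt (fun t : ℂ => p.eval (y₀ + t)) (p.derivative.eval y₀) 0 := by
  have h : HasDerivAt (fun t : ℂ => y₀ + t) 1 0 := (hasDerivAt_id' (0 : ℂ)).const_add y₀
  have h2 : HasDerivAt (fun x => p.eval x) (p.derivative.eval y₀) (y₀ + 0) := by
    simpa using p.hasDerivAt y₀
  have h3 := h2.comp (0 : ℂ) h
  rwa [mul_one] at h3

theorem natDegree_discr_le {N n₁ n₂ n₃ : ℕ} {a b d : Polynomial ℂ} (ha : a.natDegree ≤ n₁)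
    (hb : b.natDegree ≤ n₂) (hd : d.natDegree ≤ n₃) (h1 : 2 * n₂ ≤ N) (h2 : n₁ + n₃ ≤ N) :
    (b ^ 2 - 4 * a * d).natDegree ≤ N := by
  have e1 : (b ^ 2).natDegree ≤ N :=
    (Polynomial.natDegree_pow_le.trans (Nat.mul_le_mul_left 2 hb)).trans h1
  have e2 : (4 * a * d).natDegree ≤ N := by
    have h4 : (4 * a * d) = Polynomial.C 4 * (a * d) := by
      rw [mul_assoc]
      rfl
    rw [h4]
    exact (Polynomial.natDegree_C_mul_le _ _).trans
      (Polynomial.natDegree_mul_le.trans (by omega))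
  exact (Polynomial.natDegree_sub_le_of_le e1 e2).trans (max_self _).le

/-- The curve `x² + q x + s = 0` meets the graph `x = p(y)` with multiplicity the order of vanishing
of `p² + q p + s`. -/
theorem IsSingularityA.le_two_mul_of_graph {k : ℕ} (hk : 1 ≤ k) {p q s : Polynomial ℂ}
    {z : Fin 2 → ℂ} (hf : IsSingularityA k ((X 0 - inY p) * quadratic 1 q s) z)
    (hz : z 0 = p.eval (z 1)) :
    p ^ 2 + q * p + s ≠ 0 ∧ k + 1 ≤ 2 * (p ^ 2 + q * p + s).rootMultiplicity (z 1) := by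
  have hφ : HasDerivAt (fun t : ℂ => ![p.eval (z 1 + t), z 1 + t])
      ![p.derivative.eval (z 1), 1] 0 := by
    refine hasDerivAt_pi.2 fun i => ?_
    fin_cases i
    · exact hasDerivAt_graph p (z 1)
    · exact (hasDerivAt_id' (0 : ℂ)).const_add (z 1)
  exact hf.le_two_mul_rootMultiplicity hk hφ.differentiableAt
    (by ext i; fin_cases i <;> simp [hz]) (fun t ht h => ht (by simpa using congrFun h 1))
    (Eventually.of_forall fun t => by simp) 0 (by simp)
    tendsto_const_nhds one_ne_zero (Eventually.of_forall fun t => by simp)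

/-- At a point of the graph `x = p(y)`, twice its intersection number with the residual curve bounds
`k + 1`; away from the graph, the discriminant of the residual curve does. -/
theorem IsSingularityA.le_of_graph_mul_quadratic {m r k : ℕ} (hm : 2 ≤ m) (hr : r ≤ 2)
    {p q s : Polynomial ℂ} {z : Fin 2 → ℂ} (hq : q.natDegree ≤ m) (hs : s.natDegree ≤ 2 * m)
    (hR : p ^ 2 + q * p + s ≠ 0 → (p ^ 2 + q * p + s).rootMultiplicity (z 1) ≤ 2 * m - r)
    (hf : IsSingularityA k ((X 0 - inY p) * quadratic 1 q s) z) : k ≤ 4 * m - 1 - r := by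
  by_contra! hk
  by_cases hz : z 0 = p.eval (z 1)
  · obtain ⟨h0, h1⟩ := hf.le_two_mul_of_graph (by omega) hz
    have := hR h0
    omega
  · obtain ⟨-, -, h⟩ := (hf.of_mul_left (by simpa [sub_eq_zero] using hz)).le_rootMultiplicity_discr
      (by omega)
    have h1 := rootMultiplicity_le_natDegree (q ^ 2 - 4 * 1 * s) (z 1)
    have h2 := natDegree_discr_le (N := 2 * m) (Polynomial.natDegree_one (R := ℂ)).le hq hs
      (by omega) (by omega)
    omega

/-- The bound of `IsSingularityA.le_of_graph_mul_quadratic` in the chart with coordinate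
`w = 1 / x`, where the graph `x = p(y)` is `1 = p(y) w`. -/
theorem IsSingularityA.le_of_inv_graph_mul_quadratic {m r k : ℕ} (hm : 2 ≤ m) (hr : r ≤ 2)
    {p q s : Polynomial ℂ} {z : Fin 2 → ℂ} (hq : q.natDegree ≤ m) (hs : s.natDegree ≤ 2 * m)
    (hR : p ^ 2 + q * p + s ≠ 0 → (p ^ 2 + q * p + s).rootMultiplicity (z 1) ≤ 2 * m - r)
    (hf : IsSingularityA k ((1 - inY p * X 0) * quadratic s q 1) z) : k ≤ 4 * m - 1 - r := by
  by_contra! hk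
  by_cases hz : 1 - p.eval (z 1) * z 0 = 0
  · have hp : p.eval (z 1) ≠ 0 := fun h => by simp [h] at hz
    have hz0 : z 0 = (p.eval (z 1))⁻¹ := by
      field_simp
      linear_combination -hz
    have hd : HasDerivAt (fun t : ℂ => p.eval (z 1 + t)) (p.derivative.eval (z 1)) 0 :=
      hasDerivAt_graph p (z 1)
    have hpt : Tendsto (fun t : ℂ => p.eval (z 1 + t)) (𝓝 0) (𝓝 (p.eval (z 1))) := by
      simpa [ContinuousAt] using hd.continuousAt
    have hφ : HasDerivAt (fun t : ℂ => ![(p.eval (z 1 + t))⁻¹, z 1 + t])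
        ![-p.derivative.eval (z 1) / p.eval (z 1) ^ 2, 1] 0 := by
      refine hasDerivAt_pi.2 fun i => ?_
      fin_cases i
      · simpa using hd.fun_inv (by simpa using hp)
      · exact (hasDerivAt_id' (0 : ℂ)).const_add (z 1)
    obtain ⟨h0, h1⟩ := hf.le_two_mul_rootMultiplicity (by omega) hφ.differentiableAt
      (by ext i; fin_cases i <;> simp [hz0]) (fun t ht h => ht (by simpa using congrFun h 1))
      (by filter_upwards [hpt.eventually_ne hp] with t ht; simp [ht]) 0 (by simpa using hp)
      (G := p ^ 2 + q * p + s) (y₀ := z 1)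
      ((hpt.inv₀ hp).pow 2) (pow_ne_zero 2 (inv_ne_zero hp))
      (by
        filter_upwards [hpt.eventually_ne hp] with t ht
        simp
        field_simp
        ring)
    have := hR h0
    omega
  · obtain ⟨-, -, h⟩ := (hf.of_mul_left (by simpa using hz)).le_rootMultiplicity_discr (by omega)
    have h1 := rootMultiplicity_le_natDegree (q ^ 2 - 4 * s * 1) (z 1)
    have h2 := natDegree_discr_le (N := 2 * m) hs hq (Polynomial.natDegree_one (R := ℂ)).le
      (by omega) (by omega)
    omega

theorem isBigO_eval_of_eval_eq_zero {f : Poly} {s : Fin 2 → ℂ} (hf : eval s f = 0) :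
    (fun z => eval z f) =O[𝓝 s] fun z => ‖z - s‖ := by
  simpa [hf] using (hasFDerivAt_eval f s).differentiableAt.isBigO_sub.norm_right

/-- The case of a fibre along which `p`, `q` and `s` all vanish: if `s` vanishes to order one, then
the two components meet with multiplicity one; otherwise the singular point has multiplicity
three. -/
theorem IsSingularityA.le_one_of_X_dvd {k : ℕ} {p q s : Polynomial ℂ} {z : Fin 2 → ℂ}
    (hz : z 1 = 0) (hp : Polynomial.X ∣ p) (hq : Polynomial.X ∣ q) (hs : Polynomial.X ∣ s)
    (hf : IsSingularityA k ((X 0 - inY p) * quadratic 1 q s) z) : k ≤ 1 := by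
  obtain ⟨p, rfl⟩ := hp
  obtain ⟨q, rfl⟩ := hq
  obtain ⟨s, rfl⟩ := hs
  have hz0 : z 0 = 0 := by
    have := hf.eval_eq_zero
    simpa [hz] using this
  by_cases hs : s.eval 0 = 0
  · rw [← Polynomial.IsRoot.def, ← Polynomial.dvd_iff_isRoot] at hs
    obtain ⟨s, rfl⟩ := hs
    refine (hf.not_isBigO_cube ?_).elim
    have h1 := isBigO_eval_of_eval_eq_zero (s := z) (f := X 0 - inY (Polynomial.X * p))
      (by simp [hz, hz0])
    have h2 := isBigO_eval_of_eval_eq_zero (s := z) (f := X 0) (by simp [hz0])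
    have h3 := isBigO_eval_of_eval_eq_zero (s := z) (f := inY Polynomial.X) (by simp [hz])
    have h4 := isBigO_eval_of_eval_eq_zero (s := z) (f := X 0 + inY (Polynomial.X * q))
      (by simp [hz, hz0])
    have h5 := isBigO_eval_of_eval_eq_zero (s := z) (f := inY (Polynomial.X * s)) (by simp [hz])
    refine (h1.mul ((h2.mul h4).add (h3.mul h5))).congr (fun w => ?_) (fun w => ?_)
    · simp only [map_mul, map_add, map_sub, eval_quadratic, eval_inY, eval_X,
        Polynomial.eval_mul, Polynomial.eval_X, Polynomial.eval_sub, Polynomial.eval_C,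
        Polynomial.eval_one]
      ring
    · ring
  · by_contra! hk
    obtain ⟨h0, h1⟩ := hf.le_two_mul_of_graph (by omega) (by simp [hz, hz0])
    have hR : (Polynomial.X * p) ^ 2 + Polynomial.X * q * (Polynomial.X * p) + Polynomial.X * s =
        Polynomial.X * (Polynomial.X * (p ^ 2 + q * p) + s) := by ring
    rw [hR] at h0 h1
    rw [Polynomial.rootMultiplicity_mul h0, hz, Polynomial.rootMultiplicity_eq_zero
      (p := Polynomial.X * (p ^ 2 + q * p) + s) (by simpa using hs)] at h1
    have := rootMultiplicity_le_natDegree Polynomial.X 0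
    rw [Polynomial.natDegree_X] at this
    omega

/-! ### Polynomials of bidegree `(3, 3m - r)` as cubics in `x` -/

/-- The isomorphism `ℂ[x, y] ≃ ℂ[y][x]`. -/
def toIterated : Poly ≃+* Polynomial (Polynomial ℂ) :=
  RingEquiv.ofRingHom
    (aeval (R := ℂ) (![Polynomial.X, Polynomial.C Polynomial.X] :
      Fin 2 → Polynomial (Polynomial ℂ))).toRingHom
    (Polynomial.eval₂RingHom inY.toRingHom (X 0))
    (by
      ext <;> simp [inY, algebraMap_eq, Polynomial.algebraMap_apply])
    (by
      ext i
      · simp [algebraMap_eq, Polynomial.algebraMap_apply, inY]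
      · fin_cases i <;> simp [inY])

theorem toIterated_inY (a : Polynomial ℂ) : toIterated (inY a) = Polynomial.C a := by
  rw [← RingEquiv.eq_symm_apply]
  simp [toIterated]

theorem toIterated_X_zero : toIterated (X 0) = Polynomial.X := by
  simp [toIterated]

theorem exists_mem_support_of_coeff_toIterated_ne_zero {F : Poly} {i j : ℕ}
    (h : ((toIterated F).coeff i).coeff j ≠ 0) : ∃ e ∈ F.support, e 0 = i ∧ e 1 = j := by
  have hF : toIterated F =
      ∑ e ∈ F.support, Polynomial.monomial (e 0) (Polynomial.monomial (e 1) (F.coeff e)) := by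
    have h1 : toIterated F = aeval (R := ℂ) (![Polynomial.X, Polynomial.C Polynomial.X] :
      Fin 2 → Polynomial (Polynomial ℂ)) F := rfl
    rw [h1, aeval_def, eval₂_eq']
    refine Finset.sum_congr rfl fun e _ => ?_
    rw [Fin.prod_univ_two, ← Polynomial.C_mul_X_pow_eq_monomial,
      ← Polynomial.C_mul_X_pow_eq_monomial]
    simp [Polynomial.algebraMap_apply]
    ring
  rw [hF, Polynomial.finsetSum_coeff, Polynomial.finsetSum_coeff] at h
  obtain ⟨e, he, hne⟩ := Finset.exists_ne_zero_of_sum_ne_zero h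
  refine ⟨e, he, ?_⟩
  rw [Polynomial.coeff_monomial] at hne
  split_ifs at hne with h0
  · rw [Polynomial.coeff_monomial] at hne
    split_ifs at hne with h1
    · exact ⟨h0, h1⟩
    · exact absurd rfl hne
  · simp at hne

theorem HasBidegree.le_of_mem_support {a b : ℕ} {F : Poly} (hF : HasBidegree a b F)
    {e : Fin 2 →₀ ℕ} (he : e ∈ F.support) : b * e 0 + a * e 1 ≤ a * b := by
  have h1 : ((e 0 : ℝ), (e 1 : ℝ)) ∈ newtonPolygon F := subset_convexHull ℝ _ ⟨e, he, rfl⟩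
  have h2 : Convex ℝ {p : ℝ × ℝ | b * p.1 + a * p.2 ≤ a * b} :=
    convex_halfSpace_le (f := fun p : ℝ × ℝ => (b : ℝ) * p.1 + a * p.2)
      ⟨fun p q => by simp; ring, fun c p => by simp; ring⟩ _
  have h3 := convexHull_min (s := {((a : ℝ), (0 : ℝ)), (0, 0), (0, (b : ℝ))}) (by
    rintro p (rfl | rfl | rfl)
    · simp [mul_comm]
    · simp; positivity
    · simp) h2 (hF h1)
  have h4 : (b * e 0 + a * e 1 : ℝ) ≤ a * b := h3
  exact_mod_cast h4

/-- For `r ≤ 2`, the coefficient of `x³⁻ⁱ` in a polynomial of bidegree `(3, 3m - r)` has degree at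
most `i m - r i / 3`, and rounding `r i / 3` up gives `min r 1`, `r`, `r` for `i = 1, 2, 3`. -/
theorem HasBidegree.exists_eq_cubic {m r : ℕ} (hm : 2 ≤ m) (hr : r ≤ 2) {F : Poly}
    (hF : HasBidegree 3 (3 * m - r) F) :
    ∃ (c : ℂ) (a₁ a₂ a₃ : Polynomial ℂ), F = cubic (Polynomial.C c) a₁ a₂ a₃ ∧
      a₁.natDegree + min r 1 ≤ m ∧ a₂.natDegree + r ≤ 2 * m ∧ a₃.natDegree + r ≤ 3 * m := by
  have hsupp : ∀ i j, ((toIterated F).coeff i).coeff j ≠ 0 →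
      (3 * m - r) * i + 3 * j ≤ 3 * (3 * m - r) := by
    intro i j h
    obtain ⟨e, he, rfl, rfl⟩ := exists_mem_support_of_coeff_toIterated_ne_zero h
    exact hF.le_of_mem_support he
  have hdeg : (toIterated F).natDegree < 4 := by
    rw [Nat.lt_succ_iff, Polynomial.natDegree_le_iff_coeff_eq_zero]
    intro i hi
    ext j
    by_contra h
    have h1 := hsupp i j (by simpa using h)
    have h2 : (3 * m - r) * 4 ≤ (3 * m - r) * i := Nat.mul_le_mul_left _ hi
    omega
  have hcoeff : ∀ i N, (∀ j, (3 * m - r) * i + 3 * j ≤ 3 * (3 * m - r) → j ≤ N) →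
      ((toIterated F).coeff i).natDegree ≤ N := by
    intro i N h
    rw [Polynomial.natDegree_le_iff_coeff_eq_zero]
    intro j hj
    by_contra hne
    have := h j (hsupp i j hne)
    omega
  have h3 := hcoeff 3 0 (fun j hj => by omega)
  have h2 := hcoeff 2 (m - min r 1) (fun j hj => by omega)
  have h1 := hcoeff 1 (2 * m - r) (fun j hj => by omega)
  have h0 := hcoeff 0 (3 * m - r) (fun j hj => by omega)
  refine ⟨((toIterated F).coeff 3).coeff 0, (toIterated F).coeff 2, (toIterated F).coeff 1,
    (toIterated F).coeff 0, ?_, by omega, by omega, by omega⟩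
  rw [← Polynomial.eq_C_of_natDegree_le_zero h3]
  apply toIterated.injective
  simp only [cubic, map_add, map_mul, map_pow, toIterated_inY, toIterated_X_zero]
  conv_lhs => rw [Polynomial.as_sum_range_C_mul_X_pow' (toIterated F) hdeg]
  simp only [Finset.sum_range_succ, Finset.sum_range_zero]
  ring

/-- If the `i`-th coefficient of a monic cubic has degree less than `i (N + 1)`, then its roots have
degree at most `N`: otherwise the leading term dominates. -/
theorem natDegree_root_cubic_le {N : ℕ} {p b₁ b₂ b₃ : Polynomial ℂ}
    (hp : p ^ 3 + b₁ * p ^ 2 + b₂ * p + b₃ = 0)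
    (h1 : b₁.natDegree ≤ N) (h2 : b₂.natDegree ≤ 2 * N + 1) (h3 : b₃.natDegree ≤ 3 * N + 2) :
    p.natDegree ≤ N := by
  by_contra! hN
  have h4 : p ^ 3 = -(b₁ * p ^ 2 + b₂ * p + b₃) := by linear_combination hp
  have h5 : (b₁ * p ^ 2 + b₂ * p + b₃).natDegree ≤ 3 * p.natDegree - 1 := by
    have e1 : (b₁ * p ^ 2).natDegree ≤ 3 * p.natDegree - 1 := by
      refine (Polynomial.natDegree_mul_le).trans ?_
      rw [Polynomial.natDegree_pow]
      omega
    have e2 : (b₂ * p).natDegree ≤ 3 * p.natDegree - 1 := by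
      refine (Polynomial.natDegree_mul_le).trans ?_
      omega
    have e3 : b₃.natDegree ≤ 3 * p.natDegree - 1 := by omega
    exact Polynomial.natDegree_add_le_of_degree_le
      (Polynomial.natDegree_add_le_of_degree_le e1 e2) e3
  have h6 := congrArg Polynomial.natDegree h4
  rw [Polynomial.natDegree_pow, Polynomial.natDegree_neg] at h6
  omega

/-- A reducible cubic with constant leading coefficient `c` has a component which is a graph
`x = p(y)`, and the degrees in `y` are as the Newton polygon predicts. -/
theorem exists_factorization_of_not_irreducible {m r : ℕ} (hr : r ≤ 2) {c : ℂ}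
    (hc : c ≠ 0) {a₁ a₂ a₃ : Polynomial ℂ}
    (h1 : a₁.natDegree + min r 1 ≤ m) (h2 : a₂.natDegree + r ≤ 2 * m)
    (h3 : a₃.natDegree + r ≤ 3 * m)
    (hF : ¬ Irreducible (cubic (Polynomial.C c) a₁ a₂ a₃)) :
    ∃ p q s : Polynomial ℂ, a₁ = Polynomial.C c * (q - p) ∧ a₂ = Polynomial.C c * (s - p * q) ∧
      a₃ = - (Polynomial.C c * (p * s)) ∧
      p.natDegree + min r 1 ≤ m ∧ q.natDegree + min r 1 ≤ m ∧ s.natDegree + r ≤ 2 * m := by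
  -- After division by `c`, the cubic is monic, so it is reducible only if it has a root in `ℂ[y]`.
  have hcc : Polynomial.C c * Polynomial.C c⁻¹ = 1 := by
    rw [← Polynomial.C_mul, mul_inv_cancel₀ hc, Polynomial.C_1]
  have hdeg : ∀ a : Polynomial ℂ, (Polynomial.C c⁻¹ * a).natDegree ≤ a.natDegree :=
    fun a => Polynomial.natDegree_C_mul_le _ _
  obtain ⟨b₁, hb₁, ha₁⟩ : ∃ b₁ : Polynomial ℂ, b₁.natDegree + min r 1 ≤ m ∧
      a₁ = Polynomial.C c * b₁ :=
    ⟨Polynomial.C c⁻¹ * a₁, by have := hdeg a₁; omega, by rw [← mul_assoc, hcc, one_mul]⟩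
  obtain ⟨b₂, hb₂, ha₂⟩ : ∃ b₂ : Polynomial ℂ, b₂.natDegree + r ≤ 2 * m ∧
      a₂ = Polynomial.C c * b₂ :=
    ⟨Polynomial.C c⁻¹ * a₂, by have := hdeg a₂; omega, by rw [← mul_assoc, hcc, one_mul]⟩
  obtain ⟨b₃, hb₃, ha₃⟩ : ∃ b₃ : Polynomial ℂ, b₃.natDegree + r ≤ 3 * m ∧
      a₃ = Polynomial.C c * b₃ :=
    ⟨Polynomial.C c⁻¹ * a₃, by have := hdeg a₃; omega, by rw [← mul_assoc, hcc, one_mul]⟩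
  subst ha₁ ha₂ ha₃
  set P : Polynomial (Polynomial ℂ) := Polynomial.X ^ 3 + Polynomial.C b₁ * Polynomial.X ^ 2 +
    Polynomial.C b₂ * Polynomial.X + Polynomial.C b₃ with hP
  have hPF : toIterated (cubic (Polynomial.C c) (Polynomial.C c * b₁) (Polynomial.C c * b₂)
      (Polynomial.C c * b₃)) = Polynomial.C (Polynomial.C c) * P := by
    simp only [cubic, map_add, map_mul, map_pow, toIterated_inY, toIterated_X_zero, hP]
    ring
  have hP3 : P.natDegree = 3 := by
    rw [hP]
    compute_degree!
  have hPm : P.Monic := by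
    rw [hP]
    monicity!
  rw [← MulEquiv.irreducible_iff toIterated, hPF, irreducible_isUnit_mul
    (by simpa using hc), hPm.irreducible_iff_roots_eq_zero_of_degree_le_three (by omega)
    (by omega)] at hF
  obtain ⟨p, hp⟩ := Multiset.exists_mem_of_ne_zero hF
  have hp' : p ^ 3 + b₁ * p ^ 2 + b₂ * p + b₃ = 0 := by
    have := Polynomial.isRoot_of_mem_roots hp
    simpa [hP] using this
  have hpd : p.natDegree ≤ m - min r 1 :=
    natDegree_root_cubic_le hp' (by omega) (by omega) (by omega)
  have hqd : (b₁ + p).natDegree ≤ m - min r 1 :=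
    Polynomial.natDegree_add_le_of_degree_le (by omega) (by omega)
  have hpq : (p * (b₁ + p)).natDegree ≤ 2 * m - r :=
    (Polynomial.natDegree_mul_le).trans (by omega)
  have hsd : (b₂ + p * (b₁ + p)).natDegree ≤ 2 * m - r :=
    Polynomial.natDegree_add_le_of_degree_le (by omega) hpq
  refine ⟨p, b₁ + p, b₂ + p * (b₁ + p), by ring, by ring, ?_, by omega, by omega, by omega⟩
  linear_combination Polynomial.C c * hp'

/-! ### The equations of the divisor on the four charts -/

/-- The local equations on the four charts of the divisor of
`c x³ + a₁(y) x² + a₂(y) x + a₃(y)`, a section of `𝒪(3 S₊)`. In the charts around the fibre at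
infinity, the coefficient `aᵢ`, of degree at most `i m`, becomes `vⁱᵐ aᵢ(1 / v)`. -/
def chartEq (m : ℕ) (c : ℂ) (a₁ a₂ a₃ : Polynomial ℂ) : Chart → Poly
  | .x1y1 => cubic (Polynomial.C c) a₁ a₂ a₃
  | .x1y0 => cubic (Polynomial.C c) (a₁.reflect m) (a₂.reflect (2 * m)) (a₃.reflect (3 * m))
  | .x0y1 => cubic a₃ a₂ a₁ (Polynomial.C c)
  | .x0y0 => cubic (a₃.reflect (3 * m)) (a₂.reflect (2 * m)) (a₁.reflect m) (Polynomial.C c)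

theorem X_pow_dvd_reflect {a : Polynomial ℂ} {N e : ℕ} (h : a.natDegree + e ≤ N) :
    Polynomial.X ^ e ∣ a.reflect N := by
  rw [Polynomial.X_pow_dvd_iff]
  intro d hd
  rw [Polynomial.coeff_reflect, Polynomial.revAt_le (by omega)]
  exact Polynomial.coeff_eq_zero_of_natDegree_lt (by omega)

theorem natDegree_reflect_le_of_le {a : Polynomial ℂ} {N : ℕ} (h : a.natDegree ≤ N) :
    (a.reflect N).natDegree ≤ N :=
  Polynomial.natDegree_reflect_le.trans (max_le le_rfl h)

theorem cubic_zero_left (a₁ a₂ a₃ : Polynomial ℂ) : cubic 0 a₁ a₂ a₃ = quadratic a₁ a₂ a₃ := by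
  simp [cubic, quadratic]

theorem cubic_zero_right (a₁ a₂ a₃ : Polynomial ℂ) :
    cubic a₃ a₂ a₁ 0 = X 0 * quadratic a₃ a₂ a₁ := by
  simp only [cubic, quadratic, map_zero]
  ring

/-- If `x³` does not occur, then the divisor contains the negative section, which is disjoint from
`S₊`. -/
theorem IsSingularityA.le_of_chartEq_zero {m r k : ℕ} (hm : 2 ≤ m) (hr : r ≤ 2)
    {a₁ a₂ a₃ : Polynomial ℂ} (h1 : a₁.natDegree + min r 1 ≤ m) (h2 : a₂.natDegree + r ≤ 2 * m)
    (h3 : a₃.natDegree + r ≤ 3 * m) {ch : Chart} {z : Fin 2 → ℂ}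
    (hf : IsSingularityA k (chartEq m 0 a₁ a₂ a₃ ch) z) : k ≤ 4 * m - 1 - r := by
  have hD : ∀ y, (a₂ ^ 2 - 4 * a₁ * a₃).rootMultiplicity y ≤ 4 * m - r := fun y =>
    (rootMultiplicity_le_natDegree _ y).trans
      (natDegree_discr_le (n₁ := m - min r 1) (n₂ := 2 * m - r) (n₃ := 3 * m - r) (by omega)
        (by omega) (by omega) (by omega) (by omega))
  have d1 := X_pow_dvd_reflect h1
  have d2 := X_pow_dvd_reflect h2
  have d3 := X_pow_dvd_reflect h3
  have n1 := natDegree_reflect_le_of_le (a := a₁) (N := m) (by omega)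
  have n2 := natDegree_reflect_le_of_le (a := a₂) (N := 2 * m) (by omega)
  have n3 := natDegree_reflect_le_of_le (a := a₃) (N := 3 * m) (by omega)
  generalize hb1 : a₁.reflect m = b₁ at *
  generalize hb2 : a₂.reflect (2 * m) = b₂ at *
  generalize hb3 : a₃.reflect (3 * m) = b₃ at *
  have hdeg : (b₂ ^ 2 - 4 * b₁ * b₃).natDegree ≤ 4 * m :=
    natDegree_discr_le n1 n2 n3 (by omega) (by omega)
  have hdvd : Polynomial.X ^ r ∣ b₂ ^ 2 - 4 * b₁ * b₃ :=
    dvd_sub (dvd_pow d2 two_ne_zero) (dvd_mul_of_dvd_right d3 _)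
  have hD' : ∀ y, b₂ ^ 2 - 4 * b₁ * b₃ ≠ 0 → (y ≠ 0 ∨ r = 0) →
      (b₂ ^ 2 - 4 * b₁ * b₃).rootMultiplicity y ≤ 4 * m - r := by
    rintro y h0 (hy | rfl)
    · exact rootMultiplicity_le_sub_of_X_pow_dvd h0 hdeg hdvd hy
    · exact (rootMultiplicity_le_natDegree _ y).trans hdeg
  -- On the fibre at infinity, all coefficients vanish unless `r = 0`.
  have hval : ∀ b : Polynomial ℂ, ∀ e y, Polynomial.X ^ e ∣ b → b.eval y ≠ 0 → y ≠ 0 ∨ e = 0 := by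
    rintro b e y ⟨q, rfl⟩ h
    by_contra! hy
    exact h (by simp [hy.1, hy.2])
  cases ch <;> simp only [chartEq, hb1, hb2, hb3, map_zero, cubic_zero_left, cubic_zero_right] at hf
  · exact hf.le_of_quadratic hm hr fun _ _ => hD _
  · exact hf.le_of_quadratic hm hr fun h0 h =>
      hD' _ h0 ((hval _ _ _ d1 h).imp_right fun h => by omega)
  · refine hf.le_of_X_mul_quadratic hm hr (by omega) fun _ _ => ?_
    rw [show a₂ ^ 2 - 4 * a₃ * a₁ = a₂ ^ 2 - 4 * a₁ * a₃ by ring]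
    exact hD _
  · refine hf.le_of_X_mul_quadratic hm hr n1 fun h0 h => ?_
    rw [show b₂ ^ 2 - 4 * b₃ * b₁ = b₂ ^ 2 - 4 * b₁ * b₃ by ring] at h0 ⊢
    exact hD' _ h0 (hval _ _ _ d3 h)

theorem cubic_eq_graph_mul (c : ℂ) (p q s : Polynomial ℂ) :
    cubic (Polynomial.C c) (Polynomial.C c * (q - p)) (Polynomial.C c * (s - p * q))
      (-(Polynomial.C c * (p * s))) = C c * ((X 0 - inY p) * quadratic 1 q s) := by
  have : inY (Polynomial.C c) = C c := by simp [inY, algebraMap_eq]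
  simp only [cubic, quadratic, map_mul, map_sub, map_neg, map_one, this]
  ring

theorem cubic_eq_inv_graph_mul (c : ℂ) (p q s : Polynomial ℂ) :
    cubic (-(Polynomial.C c * (p * s))) (Polynomial.C c * (s - p * q)) (Polynomial.C c * (q - p))
      (Polynomial.C c) = C c * ((1 - inY p * X 0) * quadratic s q 1) := by
  have : inY (Polynomial.C c) = C c := by simp [inY, algebraMap_eq]
  simp only [cubic, quadratic, map_mul, map_sub, map_neg, map_one, this]
  ring

/-- If the affine curve is reducible and `x³` occurs, then the divisor is the union of a graph
`x = p(y)`, linearly equivalent to `S₊`, and a divisor linearly equivalent to `2 S₊`. -/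
theorem IsSingularityA.le_of_chartEq_factorization {m r k : ℕ} (hm : 2 ≤ m) (hr : r ≤ 2) {c : ℂ}
    (hc : c ≠ 0) {p q s : Polynomial ℂ} (hp : p.natDegree + min r 1 ≤ m)
    (hq : q.natDegree + min r 1 ≤ m) (hs : s.natDegree + r ≤ 2 * m) {ch : Chart} {z : Fin 2 → ℂ}
    (hf : IsSingularityA k (chartEq m c (Polynomial.C c * (q - p)) (Polynomial.C c * (s - p * q))
      (-(Polynomial.C c * (p * s))) ch) z) : k ≤ 4 * m - 1 - r := by
  have hR : ∀ y, (p ^ 2 + q * p + s).rootMultiplicity y ≤ 2 * m - r := by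
    intro y
    refine (rootMultiplicity_le_natDegree _ y).trans ?_
    have e1 : (p ^ 2).natDegree ≤ 2 * m - r :=
      (Polynomial.natDegree_pow_le).trans (by omega)
    have e2 : (q * p).natDegree ≤ 2 * m - r := Polynomial.natDegree_mul_le.trans (by omega)
    exact Polynomial.natDegree_add_le_of_degree_le
      (Polynomial.natDegree_add_le_of_degree_le e1 e2) (by omega)
  have r1 : (Polynomial.C c * (q - p)).reflect m =
      Polynomial.C c * (q.reflect m - p.reflect m) := by
    rw [Polynomial.reflect_C_mul, Polynomial.reflect_sub]
  have r2 : (Polynomial.C c * (s - p * q)).reflect (2 * m) =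
      Polynomial.C c * (s.reflect (2 * m) - p.reflect m * q.reflect m) := by
    rw [Polynomial.reflect_C_mul, Polynomial.reflect_sub, ← Polynomial.reflect_mul _ _
      (show p.natDegree ≤ m by omega) (show q.natDegree ≤ m by omega), two_mul]
  have r3 : (-(Polynomial.C c * (p * s))).reflect (3 * m) =
      -(Polynomial.C c * (p.reflect m * s.reflect (2 * m))) := by
    rw [Polynomial.reflect_neg, Polynomial.reflect_C_mul, ← Polynomial.reflect_mul _ _
      (show p.natDegree ≤ m by omega) (show s.natDegree ≤ 2 * m by omega),
      show m + 2 * m = 3 * m by ring]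
  have dp := X_pow_dvd_reflect hp
  have dq := X_pow_dvd_reflect hq
  have ds := X_pow_dvd_reflect hs
  have np := natDegree_reflect_le_of_le (a := p) (N := m) (by omega)
  have nq := natDegree_reflect_le_of_le (a := q) (N := m) (by omega)
  have ns := natDegree_reflect_le_of_le (a := s) (N := 2 * m) (by omega)
  generalize p.reflect m = p' at *
  generalize q.reflect m = q' at *
  generalize s.reflect (2 * m) = s' at *
  have hR' : ∀ y, y ≠ 0 ∨ r = 0 → p' ^ 2 + q' * p' + s' ≠ 0 →
      (p' ^ 2 + q' * p' + s').rootMultiplicity y ≤ 2 * m - r := by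
    intro y hy h0
    have e1 : (p' ^ 2).natDegree ≤ 2 * m := (Polynomial.natDegree_pow_le).trans (by omega)
    have e2 : (q' * p').natDegree ≤ 2 * m := Polynomial.natDegree_mul_le.trans (by omega)
    have hdeg : (p' ^ 2 + q' * p' + s').natDegree ≤ 2 * m :=
      Polynomial.natDegree_add_le_of_degree_le
        (Polynomial.natDegree_add_le_of_degree_le e1 e2) (by omega)
    have hdvd : Polynomial.X ^ r ∣ p' ^ 2 + q' * p' + s' := by
      have hr2 : (Polynomial.X ^ r : Polynomial ℂ) ∣
          Polynomial.X ^ min r 1 * Polynomial.X ^ min r 1 := by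
        rw [← pow_add]
        exact pow_dvd_pow _ (by omega)
      refine dvd_add (dvd_add ?_ ?_) ds
      · rw [pow_two]
        exact hr2.trans (mul_dvd_mul dp dp)
      · exact hr2.trans (mul_dvd_mul dq dp)
    rcases hy with hy | rfl
    · exact rootMultiplicity_le_sub_of_X_pow_dvd h0 hdeg hdvd hy
    · exact (rootMultiplicity_le_natDegree _ y).trans hdeg
  cases ch <;> simp only [chartEq, r1, r2, r3, cubic_eq_graph_mul, cubic_eq_inv_graph_mul] at hf <;>
    have hf := hf.of_mul_left (by simpa using hc)
  · exact hf.le_of_graph_mul_quadratic hm hr (by omega) (by omega) fun _ => hR _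
  · by_cases hz : z 1 ≠ 0 ∨ r = 0
    · exact hf.le_of_graph_mul_quadratic hm hr nq ns (hR' _ hz)
    · push Not at hz
      have hX : ∀ {e : ℕ} {a : Polynomial ℂ}, e ≠ 0 → Polynomial.X ^ e ∣ a → Polynomial.X ∣ a :=
        fun he ha => (dvd_pow_self _ he).trans ha
      have := hf.le_one_of_X_dvd hz.1 (hX (by omega) dp) (hX (by omega) dq) (hX (by omega) ds)
      omega
  · exact hf.le_of_inv_graph_mul_quadratic hm hr (by omega) (by omega) fun _ => hR _
  · by_cases hz : z 1 ≠ 0 ∨ r = 0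
    · exact hf.le_of_inv_graph_mul_quadratic hm hr nq ns (hR' _ hz)
    · push Not at hz
      have hX : ∀ {e : ℕ} {a : Polynomial ℂ}, e ≠ 0 → Polynomial.X ^ e ∣ a → a.eval 0 = 0 := by
        rintro e a he ⟨b, rfl⟩
        simp [he]
      -- The curve does not pass through the points with `z 1 = 0` in this chart.
      have := hf.eval_eq_zero
      simp [hz.1, hX (by omega) dp, hX (by omega) dq, hX hz.2 ds] at this

/-! ### Rational functions on the charts -/

theorem toFun_inY (m : ℕ) (ch : Chart) (a : Polynomial ℂ) :
    toFun m ch (inY a) = Polynomial.aeval (coord m ch 1) a := by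
  have h : (toFun m ch).comp inY = Polynomial.aeval (coord m ch 1) := by
    ext
    simp [toFun, inY]
  exact DFunLike.congr_fun h a

/-- Reflection of a polynomial of degree at most `N` is `a(y) ↦ yᴺ a(1 / y)`. -/
theorem aeval_inv_fy_reflect {a : Polynomial ℂ} {N : ℕ} (h : a.natDegree ≤ N) :
    Polynomial.aeval fy⁻¹ (a.reflect N) = Polynomial.aeval fy a / fy ^ N := by
  let := invertibleOfNonzero fy_ne_zero
  have h1 := Polynomial.eval₂_reflect_mul_pow (algebraMap ℂ FunctionField) fy N a h
  rw [invOf_eq_inv] at h1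
  rw [eq_div_iff (pow_ne_zero _ fy_ne_zero)]
  exact h1

/-- The local equations of the divisor are those of `3 S₊` multiplied by the rational function
`F / x³`. -/
theorem toFun_chartEq {m : ℕ} {c : ℂ} {a₁ a₂ a₃ : Polynomial ℂ} (h1 : a₁.natDegree ≤ m)
    (h2 : a₂.natDegree ≤ 2 * m) (h3 : a₃.natDegree ≤ 3 * m) (ch : Chart) :
    toFun m ch (chartEq m c a₁ a₂ a₃ ch) =
      algebraMap Poly FunctionField (cubic (Polynomial.C c) a₁ a₂ a₃) / fx ^ 3 *
        toFun m ch (sPlusEq ch) ^ 3 := by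
  have hx := fx_ne_zero
  have hy := fy_ne_zero
  have hcub : ∀ b₀ b₁ b₂ b₃, toFun m ch (cubic b₀ b₁ b₂ b₃) =
      Polynomial.aeval (coord m ch 1) b₀ * coord m ch 0 ^ 3 +
      Polynomial.aeval (coord m ch 1) b₁ * coord m ch 0 ^ 2 +
      Polynomial.aeval (coord m ch 1) b₂ * coord m ch 0 + Polynomial.aeval (coord m ch 1) b₃ := by
    intro b₀ b₁ b₂ b₃
    simp only [cubic, map_add, map_mul, map_pow, toFun_inY]
    simp [toFun]
  have hF : algebraMap Poly FunctionField (cubic (Polynomial.C c) a₁ a₂ a₃) =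
      Polynomial.aeval fy (Polynomial.C c) * fx ^ 3 + Polynomial.aeval fy a₁ * fx ^ 2 +
      Polynomial.aeval fy a₂ * fx + Polynomial.aeval fy a₃ := by
    have h : ∀ a, algebraMap Poly FunctionField (inY a) = Polynomial.aeval fy a := by
      intro a
      have h : (IsScalarTower.toAlgHom ℂ Poly FunctionField).comp inY = Polynomial.aeval fy := by
        ext
        simp [fy, inY]
      exact DFunLike.congr_fun h a
    simp only [cubic, map_add, map_mul, map_pow, h]
    rfl
  rw [hF]
  cases ch <;>
    simp only [chartEq, hcub, sPlusEq, coord, Matrix.cons_val_zero, Matrix.cons_val_one,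
      aeval_inv_fy_reflect h1, aeval_inv_fy_reflect h2, aeval_inv_fy_reflect h3,
      Polynomial.aeval_C, map_one]
  · simp only [toFun, aeval_X, coord, Matrix.cons_val_zero]
    field_simp
  · simp only [toFun, aeval_X, coord, Matrix.cons_val_zero]
    field_simp
    ring
  · field_simp
    ring
  · field_simp
    ring

/-- The values of the coordinates of a chart at the point `(x, y) = (u, v)`. -/
def coordValue (m : ℕ) : Chart → ℂ → ℂ → Fin 2 → ℂ
  | .x1y1, u, v => ![u, v]
  | .x1y0, u, v => ![u / v ^ m, v⁻¹]
  | .x0y1, u, v => ![u⁻¹, v]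
  | .x0y0, u, v => ![v ^ m / u, v⁻¹]

theorem exists_coord_mul_pow_eq (m : ℕ) (ch : Chart) (i : Fin 2) : ∃ (N : ℕ) (q : Poly),
    coord m ch i * (fx * fy) ^ N = algebraMap Poly FunctionField q ∧
    ∀ u v : ℂ, u ≠ 0 → v ≠ 0 → eval ![u, v] q = (u * v) ^ N * coordValue m ch u v i := by
  have hx := fx_ne_zero
  have hy := fy_ne_zero
  have aux : ∀ (N : ℕ) (q : Poly), coord m ch i * (fx * fy) ^ N = algebraMap Poly FunctionField q →
    (∀ u v : ℂ, u ≠ 0 → v ≠ 0 → eval ![u, v] q = (u * v) ^ N * coordValue m ch u v i) →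
    ∃ (N : ℕ) (q : Poly), coord m ch i * (fx * fy) ^ N = algebraMap Poly FunctionField q ∧
    ∀ u v : ℂ, u ≠ 0 → v ≠ 0 → eval ![u, v] q = (u * v) ^ N * coordValue m ch u v i :=
    fun N q h1 h2 => ⟨N, q, h1, h2⟩
  cases ch <;> fin_cases i
  · exact aux 0 (X 0) (by simp [coord, fx]) (by simp [coordValue])
  · exact aux 0 (X 1) (by simp [coord, fy]) (by simp [coordValue])
  · refine aux m (X 0 ^ (m + 1)) ?_ (fun u v hu hv => ?_)
    · simp only [coord, map_pow]
      change fx / fy ^ m * (fx * fy) ^ m = fx ^ (m + 1)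
      field_simp
      ring
    · simp [coordValue]
      field_simp
      ring
  · refine aux 1 (X 0) ?_ (fun u v hu hv => ?_)
    · change fy⁻¹ * (fx * fy) ^ 1 = fx
      field_simp
    · simp [coordValue]
      field_simp
  · refine aux 1 (X 1) ?_ (fun u v hu hv => ?_)
    · change fx⁻¹ * (fx * fy) ^ 1 = fy
      field_simp
    · simp [coordValue]
      field_simp
  · exact aux 0 (X 1) (by simp [coord, fy]) (by simp [coordValue])
  · refine aux 1 (X 1 ^ (m + 1)) ?_ (fun u v hu hv => ?_)
    · simp only [map_pow]
      change fy ^ m / fx * (fx * fy) ^ 1 = fy ^ (m + 1)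
      field_simp
      ring
    · simp [coordValue]
      field_simp
      ring
  · refine aux 1 (X 0) ?_ (fun u v hu hv => ?_)
    · change fy⁻¹ * (fx * fy) ^ 1 = fx
      field_simp
    · simp [coordValue]
      field_simp

/-- A polynomial in the coordinates of a chart becomes a polynomial in `x` and `y` after
multiplication by a power of `x y`, compatibly with evaluation at points with `x y ≠ 0`. -/
theorem exists_toFun_mul_pow_eq (m : ℕ) (ch : Chart) (p : Poly) : ∃ (N : ℕ) (q : Poly),
    toFun m ch p * (fx * fy) ^ N = algebraMap Poly FunctionField q ∧
    ∀ u v : ℂ, u ≠ 0 → v ≠ 0 → eval ![u, v] q = (u * v) ^ N * eval (coordValue m ch u v) p := by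
  have hxy : fx * fy = algebraMap Poly FunctionField (X 0 * X 1) := by simp [fx, fy]
  induction p using MvPolynomial.induction_on with
  | C c =>
    refine ⟨0, C c, ?_, by simp⟩
    rw [pow_zero, mul_one, ← algebraMap_eq, ← IsScalarTower.algebraMap_apply]
    exact AlgHom.commutes _ c
  | add p₁ p₂ h₁ h₂ =>
    obtain ⟨N₁, q₁, h₁, e₁⟩ := h₁
    obtain ⟨N₂, q₂, h₂, e₂⟩ := h₂
    refine ⟨N₁ + N₂, q₁ * (X 0 * X 1) ^ N₂ + q₂ * (X 0 * X 1) ^ N₁, ?_, fun u v hu hv => ?_⟩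
    · rw [map_add, map_add, map_mul, map_mul, ← h₁, ← h₂, map_pow, map_pow, ← hxy]
      ring
    · simp only [map_add, map_mul, map_pow, e₁ u v hu hv, e₂ u v hu hv]
      simp
      ring
  | mul_X p i h =>
    obtain ⟨N₁, q₁, h₁, e₁⟩ := h
    obtain ⟨N₂, q₂, h₂, e₂⟩ := exists_coord_mul_pow_eq m ch i
    refine ⟨N₁ + N₂, q₁ * q₂, ?_, fun u v hu hv => ?_⟩
    · have : toFun m ch (X i) = coord m ch i := by simp [toFun]
      rw [map_mul, map_mul, ← h₁, ← h₂, this]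
      ring
    · simp only [map_mul, e₁ u v hu hv, e₂ u v hu hv, eval_X]
      ring

theorem exists_coordValue_eq (m : ℕ) (ch : Chart) {a b : ℂ} (ha : a ≠ 0) (hb : b ≠ 0) :
    ∃ u v : ℂ, u ≠ 0 ∧ v ≠ 0 ∧ coordValue m ch u v = ![a, b] := by
  cases ch
  · exact ⟨a, b, ha, hb, rfl⟩
  · exact ⟨a / b ^ m, b⁻¹, by simp [ha, hb], by simp [hb], by simp [coordValue, hb]⟩
  · exact ⟨a⁻¹, b, by simp [ha], hb, by simp [coordValue]⟩
  · exact ⟨(a * b ^ m)⁻¹, b⁻¹, by simp [ha, hb], by simp [hb], by simp [coordValue]; field_simp⟩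

/-- The coordinates of a chart are algebraically independent: a relation between them vanishes at
all points with nonzero coordinates. -/
theorem toFun_injective (m : ℕ) (ch : Chart) : Function.Injective (toFun m ch) := by
  rw [injective_iff_map_eq_zero]
  intro p hp
  obtain ⟨N, q, h, e⟩ := exists_toFun_mul_pow_eq m ch p
  rw [hp, zero_mul, eq_comm, map_eq_zero_iff _ (IsFractionRing.injective Poly FunctionField)] at h
  subst h
  have hX : p * (X 0 * X 1) = 0 := by
    refine MvPolynomial.funext fun z => ?_
    by_cases hz : z 0 = 0 ∨ z 1 = 0
    · rcases hz with hz | hz <;> simp [hz]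
    · push Not at hz
      obtain ⟨u, v, hu, hv, huv⟩ := exists_coordValue_eq m ch hz.1 hz.2
      have hz' : ![z 0, z 1] = z := by
        ext i
        fin_cases i <;> rfl
      have := e u v hu hv
      rw [huv, hz', map_zero, eq_comm, mul_eq_zero, or_iff_right (by simp [hu, hv])] at this
      simp [this]
  exact (mul_eq_zero.1 hX).resolve_right (mul_ne_zero (X_ne_zero _) (X_ne_zero _))

/-- The functions which become polynomials in the coordinates of a chart after multiplication by a
power of the product of these coordinates. They are the regular functions on the torus `x y ≠ 0`,
which is contained in all four charts. -/
def torusRing (m : ℕ) (ch : Chart) : Subalgebra ℂ FunctionField where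
  carrier := {w | ∃ (N : ℕ) (q : Poly), w * toFun m ch ((X 0 * X 1) ^ N) = toFun m ch q}
  mul_mem' := by
    rintro w₁ w₂ ⟨N₁, q₁, h₁⟩ ⟨N₂, q₂, h₂⟩
    refine ⟨N₁ + N₂, q₁ * q₂, ?_⟩
    rw [map_mul, ← h₁, ← h₂, pow_add, map_mul]
    ring
  add_mem' := by
    rintro w₁ w₂ ⟨N₁, q₁, h₁⟩ ⟨N₂, q₂, h₂⟩
    refine ⟨N₁ + N₂, q₁ * (X 0 * X 1) ^ N₂ + q₂ * (X 0 * X 1) ^ N₁, ?_⟩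
    rw [map_add, map_mul, map_mul, ← h₁, ← h₂, pow_add, map_mul]
    ring
  algebraMap_mem' c := ⟨0, C c, by
    rw [pow_zero, map_one, mul_one, ← algebraMap_eq, AlgHom.commutes]⟩

theorem overlapRing_le_torusRing (m : ℕ) (ch ch' : Chart) :
    overlapRing m ch ch' ≤ torusRing m ch := by
  have hx := fx_ne_zero
  have hy := fy_ne_zero
  have hX : ∀ i, toFun m ch (X i) = coord m ch i := fun i => by simp [toFun]
  have h1 : fx ∈ torusRing m ch := by
    cases ch
    · exact ⟨0, X 0, by simp [hX, coord]⟩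
    · exact ⟨m, X 0 ^ (m + 1), by simp [hX, coord, mul_pow]; ring⟩
    · exact ⟨1, X 1, by simp [hX, coord]; field_simp⟩
    · exact ⟨m + 1, X 0 ^ m * X 1, by simp [hX, coord, mul_pow, pow_succ]; field_simp⟩
  have h2 : fx⁻¹ ∈ torusRing m ch := by
    cases ch
    · exact ⟨1, X 1, by simp [hX, coord]; field_simp⟩
    · exact ⟨1, X 1 ^ (m + 1), by simp [hX, coord]; field_simp; ring⟩
    · exact ⟨0, X 0, by simp [hX, coord]⟩
    · exact ⟨0, X 0 * X 1 ^ m, by simp [hX, coord]; field_simp⟩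
  have h3 : fy ∈ torusRing m ch := by
    cases ch
    · exact ⟨0, X 1, by simp [hX, coord]⟩
    · exact ⟨1, X 0, by simp [hX, coord]; field_simp⟩
    · exact ⟨0, X 1, by simp [hX, coord]⟩
    · exact ⟨1, X 0, by simp [hX, coord]; field_simp⟩
  have h4 : fy⁻¹ ∈ torusRing m ch := by
    cases ch
    · exact ⟨1, X 0, by simp [hX, coord]; field_simp⟩
    · exact ⟨0, X 1, by simp [hX, coord]⟩
    · exact ⟨1, X 0, by simp [hX, coord]; field_simp⟩
    · exact ⟨0, X 1, by simp [hX, coord]⟩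
  have h : ∀ ch' i, coord m ch' i ∈ torusRing m ch := by
    intro ch' i
    cases ch' <;> fin_cases i
    · exact h1
    · exact h3
    · change fx / fy ^ m ∈ _
      rw [div_eq_mul_inv, ← inv_pow]
      exact mul_mem h1 (pow_mem h4 m)
    · exact h4
    · exact h2
    · exact h3
    · change fy ^ m / fx ∈ _
      rw [div_eq_mul_inv]
      exact mul_mem (pow_mem h3 m) h2
    · exact h4
  refine Algebra.adjoin_le ?_
  rintro w (⟨i, rfl⟩ | ⟨i, rfl⟩)
  · exact h ch i
  · exact h ch' i

/-! ### The divisor of a polynomial -/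

theorem associates_mk_eq_mk_iff {p q : Poly} :
    Associates.mk p = Associates.mk q ↔ ∃ κ : ℂ, κ ≠ 0 ∧ p = C κ * q := by
  rw [Associates.mk_eq_mk_iff_associated, Associated.comm]
  constructor
  · rintro ⟨u, rfl⟩
    obtain ⟨κ, hκ, h⟩ := isUnit_iff_eq_C_of_isReduced.1 u.isUnit
    exact ⟨κ, hκ.ne_zero, by rw [h, mul_comm]⟩
  · rintro ⟨κ, hκ, rfl⟩
    obtain ⟨u, hu⟩ := (isUnit_iff_ne_zero.2 hκ).map (C (σ := Fin 2))
    exact ⟨u, by rw [hu, mul_comm]⟩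

theorem toFun_C (m : ℕ) (ch : Chart) (κ : ℂ) :
    toFun m ch (C κ) = algebraMap ℂ FunctionField κ := by
  rw [← algebraMap_eq, AlgHom.commutes]

theorem toFun_x1y1 (m : ℕ) (p : Poly) : toFun m .x1y1 p = algebraMap Poly FunctionField p := by
  have h : toFun m .x1y1 = IsScalarTower.toAlgHom ℂ Poly FunctionField := by
    ext i
    fin_cases i <;> simp [toFun, coord, fx, fy]
  rw [h]
  rfl

theorem exists_unit_toFun_sPlusEq (m : ℕ) (ch ch' : Chart) : ∃ v : (overlapRing m ch ch')ˣ,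
    toFun m ch (sPlusEq ch) = (v : FunctionField) * toFun m ch' (sPlusEq ch') := by
  have h := toFun_sPlusEq_ne_zero m ch
  have h' := toFun_sPlusEq_ne_zero m ch'
  have hi := toFun_sPlusEq_div_mem m ch' ch
  rw [overlapRing_comm] at hi
  refine ⟨⟨⟨_, toFun_sPlusEq_div_mem m ch ch'⟩, ⟨_, hi⟩, ?_, ?_⟩, ?_⟩
  · apply Subtype.ext
    simp only [MulMemClass.mk_mul_mk, OneMemClass.coe_one]
    field_simp
  · apply Subtype.ext
    simp only [MulMemClass.mk_mul_mk, OneMemClass.coe_one]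
    field_simp
  · simp only
    field_simp

theorem localEq_sPlus_pow (m n : ℕ) (ch : Chart) :
    (sPlus m ^ n).localEq ch = Associates.mk (sPlusEq ch ^ n) := by
  rw [Associates.mk_pow]
  rfl

section

variable {m : ℕ} {c : ℂ} {a₁ a₂ a₃ : Polynomial ℂ}

theorem exists_isDivisorOf_cubic (h1 : a₁.natDegree ≤ m) (h2 : a₂.natDegree ≤ 2 * m)
    (h3 : a₃.natDegree ≤ 3 * m) (h0 : cubic (Polynomial.C c) a₁ a₂ a₃ ≠ 0) :
    ∃ D : EffectiveDivisor m, IsDivisorOf 3 (cubic (Polynomial.C c) a₁ a₂ a₃) D := by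
  have hg : algebraMap Poly FunctionField (cubic (Polynomial.C c) a₁ a₂ a₃) / fx ^ 3 ≠ 0 := by
    refine div_ne_zero ?_ (pow_ne_zero 3 fx_ne_zero)
    rwa [Ne, map_eq_zero_iff _ (IsFractionRing.injective Poly FunctionField)]
  have hne : ∀ ch, chartEq m c a₁ a₂ a₃ ch ≠ 0 := by
    intro ch h
    have h4 := toFun_chartEq h1 h2 h3 (c := c) ch
    rw [h, map_zero, eq_comm] at h4
    exact mul_ne_zero hg (pow_ne_zero 3 (toFun_sPlusEq_ne_zero m ch)) h4
  refine ⟨⟨fun ch => Associates.mk (chartEq m c a₁ a₂ a₃ ch), chartEq m c a₁ a₂ a₃,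
    fun ch => ⟨hne ch, rfl⟩, fun ch ch' => ?_⟩, ⟨_, hg, fun ch => ?_⟩, rfl⟩
  · obtain ⟨v, hv⟩ := exists_unit_toFun_sPlusEq m ch ch'
    refine ⟨v ^ 3, ?_⟩
    rw [toFun_chartEq h1 h2 h3, toFun_chartEq h1 h2 h3, hv]
    push_cast
    ring
  · exact ⟨_, _, rfl, (localEq_sPlus_pow m 3 ch).symm, by
      rw [toFun_chartEq h1 h2 h3, map_pow]⟩

theorem IsDivisorOf.localEq_eq (h1 : a₁.natDegree ≤ m) (h2 : a₂.natDegree ≤ 2 * m)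
    (h3 : a₃.natDegree ≤ 3 * m) {D : EffectiveDivisor m}
    (hD : IsDivisorOf 3 (cubic (Polynomial.C c) a₁ a₂ a₃) D) (ch : Chart) :
    D.localEq ch = Associates.mk (chartEq m c a₁ a₂ a₃ ch) := by
  obtain ⟨⟨g, hg, h⟩, hF⟩ := hD
  -- The rational function `g` is a constant multiple of `F / x³`.
  have hg' : ∃ κ : ℂ, κ ≠ 0 ∧ g = algebraMap ℂ FunctionField κ *
      (algebraMap Poly FunctionField (cubic (Polynomial.C c) a₁ a₂ a₃) / fx ^ 3) := by
    obtain ⟨p, q, hp, hq, hpq⟩ := h .x1y1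
    rw [hF, associates_mk_eq_mk_iff] at hp
    rw [localEq_sPlus_pow, associates_mk_eq_mk_iff] at hq
    obtain ⟨κ, hκ, rfl⟩ := hp
    obtain ⟨ν, hν, rfl⟩ := hq
    have hν' : algebraMap ℂ FunctionField ν ≠ 0 := by simpa using hν
    have hx : algebraMap Poly FunctionField (sPlusEq .x1y1) = fx := rfl
    rw [map_mul, map_mul, toFun_C, toFun_C, toFun_x1y1, toFun_x1y1, map_pow, hx] at hpq
    refine ⟨κ / ν, div_ne_zero hκ hν, ?_⟩
    have := fx_ne_zero
    rw [map_div₀]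
    field_simp
    linear_combination -hpq
  obtain ⟨κ, hκ, rfl⟩ := hg'
  obtain ⟨p, q, hp, hq, hpq⟩ := h ch
  rw [localEq_sPlus_pow, associates_mk_eq_mk_iff] at hq
  obtain ⟨ν, hν, rfl⟩ := hq
  rw [← hp, associates_mk_eq_mk_iff]
  refine ⟨κ * ν, mul_ne_zero hκ hν, toFun_injective m ch ?_⟩
  rw [hpq, map_mul, map_mul, toFun_C, toFun_C, toFun_chartEq h1 h2 h3, map_mul, map_pow]
  ring

theorem existsUnique_isDivisorOf_cubic (h1 : a₁.natDegree ≤ m) (h2 : a₂.natDegree ≤ 2 * m)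
    (h3 : a₃.natDegree ≤ 3 * m) (h0 : cubic (Polynomial.C c) a₁ a₂ a₃ ≠ 0) :
    ∃! D : EffectiveDivisor m, IsDivisorOf 3 (cubic (Polynomial.C c) a₁ a₂ a₃) D := by
  obtain ⟨D, hD⟩ := exists_isDivisorOf_cubic h1 h2 h3 h0
  refine ⟨D, hD, fun E hE => Subtype.ext (funext fun ch => ?_)⟩
  exact (hE.localEq_eq h1 h2 h3 ch).trans (hD.localEq_eq h1 h2 h3 ch).symm

/-- An effective divisor which does not meet the image of `ι_m` is supported on the coordinate lines
of the other charts. -/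
theorem exists_dvd_pow_of_localEq_eq_one {D : EffectiveDivisor m} (hD : D.localEq .x1y1 = 1)
    (ch : Chart) : ∃ (p : Poly) (N : ℕ), Associates.mk p = D.localEq ch ∧ p ∣ (X 0 * X 1) ^ N := by
  obtain ⟨p, hp, hpv⟩ := D.2
  obtain ⟨κ, hκ, hκp⟩ := associates_mk_eq_mk_iff.1
    (((hp .x1y1).2.trans hD).trans Associates.mk_one.symm)
  obtain ⟨v, hv⟩ := hpv ch .x1y1
  obtain ⟨N, q, hq⟩ := overlapRing_le_torusRing m ch .x1y1 (v⁻¹ : (overlapRing m ch .x1y1)ˣ).1.2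
  refine ⟨p ch, N, (hp ch).2, C κ⁻¹ * q, toFun_injective m ch ?_⟩
  have hvv : ((v : overlapRing m ch .x1y1) : FunctionField) *
      ((v⁻¹ : (overlapRing m ch .x1y1)ˣ) : overlapRing m ch .x1y1) = 1 :=
    congrArg Subtype.val v.mul_inv
  rw [map_mul, map_mul, ← hq, hv, hκp, mul_one, toFun_C, toFun_C, map_inv₀]
  have hκ' : algebraMap ℂ FunctionField κ ≠ 0 := by simpa using hκ
  field_simp
  linear_combination (-toFun m ch ((X 0 * X 1) ^ N)) * hvv

theorem X_zero_not_dvd {f : Poly} {y : ℂ} (h : eval ![0, y] f ≠ 0) : ¬ X 0 ∣ f := by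
  rintro ⟨g, rfl⟩
  simp at h

theorem X_one_not_dvd {f : Poly} {x : ℂ} (h : eval ![x, 0] f ≠ 0) : ¬ X 1 ∣ f := by
  rintro ⟨g, rfl⟩
  simp at h

@[simp] theorem eval_cubic (a₀ a₁ a₂ a₃ : Polynomial ℂ) (z : Fin 2 → ℂ) :
    eval z (cubic a₀ a₁ a₂ a₃) = a₀.eval (z 1) * z 0 ^ 3 + a₁.eval (z 1) * z 0 ^ 2 +
      a₂.eval (z 1) * z 0 + a₃.eval (z 1) := by
  simp [cubic]

/-- If `x³` occurs in an irreducible polynomial, then the local equations of its divisor on the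
charts other than the affine plane are not divisible by a coordinate. -/
theorem not_X_dvd_chartEq (hc : c ≠ 0) (hF : Irreducible (cubic (Polynomial.C c) a₁ a₂ a₃))
    {ch : Chart} (hch : ch ≠ .x1y1) :
    ¬ X 0 ∣ chartEq m c a₁ a₂ a₃ ch ∧ ¬ X 1 ∣ chartEq m c a₁ a₂ a₃ ch := by
  cases ch
  · exact absurd rfl hch
  · constructor
    · have ha : a₃.reflect (3 * m) ≠ 0 := by
        rw [Ne, Polynomial.reflect_eq_zero_iff]
        rintro rfl
        have hq : cubic (Polynomial.C c) a₁ a₂ 0 = X 0 * quadratic (Polynomial.C c) a₁ a₂ := by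
          simp only [cubic, quadratic, map_zero]
          ring
        rw [hq] at hF
        rcases hF.isUnit_or_isUnit rfl with h | h
        · exact X_prime.not_isUnit h
        · obtain ⟨κ, -, h⟩ := isUnit_iff_eq_C_of_isReduced.1 h
          have h0 := eval_pderiv_zero_quadratic (Polynomial.C c) a₁ a₂ ![0, 0]
          have h1 := eval_pderiv_zero_quadratic (Polynomial.C c) a₁ a₂ ![1, 0]
          simp [h] at h0 h1
          simp [← h0, hc] at h1
      obtain ⟨y, hy⟩ : ∃ y, (a₃.reflect (3 * m)).eval y ≠ 0 := by
        by_contra! h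
        exact ha (Polynomial.funext fun y => by simpa using h y)
      exact X_zero_not_dvd (y := y) (by simpa [chartEq] using hy)
    · intro h
      have h' : ∀ x, eval ![x, 0] (chartEq m c a₁ a₂ a₃ .x1y0) = 0 := fun x => by
        by_contra hx
        exact X_one_not_dvd hx h
      have e0 := h' 0
      have e1 := h' 1
      have e2 := h' (-1)
      have e3 := h' 2
      -- The third difference of a cubic polynomial recovers its leading coefficient.
      simp [chartEq] at e0 e1 e2 e3
      apply hc
      linear_combination (e3 - 3 * e1 - e2 + 3 * e0) / 6
  · exact ⟨X_zero_not_dvd (y := 0) (by simpa [chartEq] using hc),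
      X_one_not_dvd (x := 0) (by simpa [chartEq] using hc)⟩
  · exact ⟨X_zero_not_dvd (y := 0) (by simpa [chartEq] using hc),
      X_one_not_dvd (x := 0) (by simpa [chartEq] using hc)⟩

theorem isUnit_of_dvd_pow {p f : Poly} {N : ℕ} (hp : p ∣ (X 0 * X 1) ^ N) (hpf : p ∣ f)
    (h0 : ¬ X 0 ∣ f) (h1 : ¬ X 1 ∣ f) : IsUnit p := by
  have e : ∀ i, ¬ X i ∣ f → IsRelPrime p (X i ^ N) := fun i hi =>
    ((X_prime.irreducible.isRelPrime_iff_not_dvd.2 fun h => hi (h.trans hpf)).pow_left).symm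
  rw [mul_pow] at hp
  exact ((e 0 h0).mul_right (e 1 h1)).isUnit_of_dvd hp

/-- Of two summands of the divisor, one has no point in the affine plane, since the affine curve is
irreducible. Its other local equations are then monomials, and they are constant because they divide
local equations of the divisor, which contain no coordinate line. -/
theorem IsDivisorOf.irreducible (h1 : a₁.natDegree ≤ m) (h2 : a₂.natDegree ≤ 2 * m)
    (h3 : a₃.natDegree ≤ 3 * m) (hc : c ≠ 0)
    (hF : Irreducible (cubic (Polynomial.C c) a₁ a₂ a₃)) {D : EffectiveDivisor m}
    (hD : IsDivisorOf 3 (cubic (Polynomial.C c) a₁ a₂ a₃) D) : Irreducible D := by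
  have hloc : ∀ (A B : EffectiveDivisor m) ch, (A * B).localEq ch = A.localEq ch * B.localEq ch :=
    fun _ _ _ => rfl
  have key : ∀ A B : EffectiveDivisor m, D = A * B → A.localEq .x1y1 = 1 → IsUnit A := by
    intro A B hAB hA
    suffices A = 1 by
      rw [this]
      exact isUnit_one
    refine Subtype.ext (funext fun ch => ?_)
    change A.localEq ch = 1
    by_cases hch : ch = .x1y1
    · rw [hch, hA]
    · obtain ⟨p, N, hp, hpN⟩ := exists_dvd_pow_of_localEq_eq_one hA ch
      have hpf : p ∣ chartEq m c a₁ a₂ a₃ ch := by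
        rw [← Associates.mk_dvd_mk, ← hD.localEq_eq h1 h2 h3 ch, hAB, hloc, hp]
        exact dvd_mul_right _ _
      obtain ⟨n0, n1⟩ := not_X_dvd_chartEq (m := m) hc hF hch
      rw [← hp, Associates.mk_eq_one]
      exact isUnit_of_dvd_pow hpN hpf n0 n1
  rw [← Associates.irreducible_mk, ← hD.2] at hF
  constructor
  · intro h
    obtain ⟨B, hB⟩ := h.exists_right_inv
    refine hF.not_isUnit (IsUnit.of_mul_eq_one (B.localEq .x1y1) ?_)
    rw [← hloc, hB]
    rfl
  · intro A B hAB
    have h := hF.isUnit_or_isUnit (a := A.localEq .x1y1) (b := B.localEq .x1y1)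
      (by rw [hAB, hloc])
    rw [Associates.isUnit_iff_eq_one, Associates.isUnit_iff_eq_one] at h
    exact h.imp (key A B hAB) (key B A (hAB.trans (mul_comm A B)))

end

end Hirzebruch

end

open Hirzebruch in
theorem lemma3p9 (m r : ℕ) (hm : 2 ≤ m) (hr : r ∈ ({0, 1, 2} : Set ℕ))
    (F : Hirzebruch.Poly) (hF0 : F ≠ 0) (hF : Hirzebruch.HasBidegree 3 (3 * m - r) F) :
    (∃! C : Hirzebruch.EffectiveDivisor m, Hirzebruch.IsDivisorOf 3 F C) ∧
    (∀ C : Hirzebruch.EffectiveDivisor m, Hirzebruch.IsDivisorOf 3 F C →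
      Irreducible C ∨
        ((∀ (k : ℕ) (s : Hirzebruch.Surface m), C.HasSingularityA k s → k ≤ 4 * m - 1 - r) ∧
          ∀ (k : ℕ) (s : Fin 2 → ℂ), Hirzebruch.IsSingularityA k F s → k ≤ 4 * m - 1 - r)) ∧
    (Irreducible F ∨
      ∀ (k : ℕ) (s : Fin 2 → ℂ), Hirzebruch.IsSingularityA k F s → k ≤ 4 * m - 1 - r) := by
  have hr2 : r ≤ 2 := by
    rcases hr with rfl | rfl | rfl <;> norm_num
  obtain ⟨c, a₁, a₂, a₃, rfl, d1, d2, d3⟩ := hF.exists_eq_cubic hm hr2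
  have h1 : a₁.natDegree ≤ m := by omega
  have h2 : a₂.natDegree ≤ 2 * m := by omega
  have h3 : a₃.natDegree ≤ 3 * m := by omega
  have bound : (c = 0 ∨ ¬ Irreducible (cubic (Polynomial.C c) a₁ a₂ a₃)) →
      ∀ (k : ℕ) (ch : Chart) (z : Fin 2 → ℂ), IsSingularityA k (chartEq m c a₁ a₂ a₃ ch) z →
        k ≤ 4 * m - 1 - r := by
    intro h k ch z hs
    by_cases hc : c = 0
    · subst hc
      exact hs.le_of_chartEq_zero hm hr2 d1 d2 d3
    · obtain ⟨p, q, s, rfl, rfl, rfl, hp, hq, hs'⟩ :=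
        exists_factorization_of_not_irreducible hr2 hc d1 d2 d3 (h.resolve_left hc)
      exact hs.le_of_chartEq_factorization hm hr2 hc hp hq hs'
  refine ⟨existsUnique_isDivisorOf_cubic h1 h2 h3 hF0, fun D hD => ?_, ?_⟩
  · by_cases h : c = 0 ∨ ¬ Irreducible (cubic (Polynomial.C c) a₁ a₂ a₃)
    · refine Or.inr ⟨?_, fun k s hs => bound h k .x1y1 s hs⟩
      rintro k s ⟨ch, z, f, -, hf, hs⟩
      rw [hD.localEq_eq h1 h2 h3, associates_mk_eq_mk_iff] at hf
      obtain ⟨κ, hκ, rfl⟩ := hf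
      exact bound h k ch z (hs.of_mul_left (by simpa using hκ))
    · push Not at h
      exact Or.inl (hD.irreducible h1 h2 h3 h.1 h.2)
  · by_cases h : Irreducible (cubic (Polynomial.C c) a₁ a₂ a₃)
    · exact Or.inl h
    · exact Or.inr fun k s hs => bound (Or.inr h) k .x1y1 s hs
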